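/- Let $d\ge 1$. A $d$-complex here is a (finite or infinite) non-empty simplicial complex $X$ that is uniform of dimension $d$ (every cell lies in a $d$-cell, i.e. a cell with $d+1$ vertices, and no cell has more vertices), whose $(d-1)$-cells have globally bounded degrees (the degree $\deg\sigma$ of a $(d-1)$-cell is the number of $d$-cells containing it), and which is $(d-1)$-connected (any two $(d-1)$-cells are joined by a chain of $(d-1)$-cells in which the union of any two consecutive ones is a $d$-cell). Let $\Omega^{d-1}_{L^2}(X)$ be the Hilbert space of real antisymmetric functions $f$ on the oriented $(d-1)$-cells of $X$ (for $d=1$: all real functions on the vertices) with $\|f\|^2=\sum_{\sigma\in X^{d-1}}f(\sigma)^2/\deg\sigma<\infty$, and let $\Omega^{d}_{L^2}(X)$ be the space of square-summable antisymmetric functions on the oriented $d$-cells. Let $$(\partial_d F)(\sigma)=\sum_{v\notin\sigma,\ v\sigma\in X}F(v\sigma),\qquad (\delta_d f)(\tau)=\sum_{i=0}^{d}\frac{(-1)^i f(\tau\setminus\tau_i)}{\deg(\tau\setminus\tau_i)},\qquad \Delta^+_X=\partial_d\delta_d ,$$ and let $A(X,0)$ be the transition operator of the non-lazy $(d-1)$-walk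 on $\Omega^{d-1}_{L^2}(X)$, $$(A(X,0)f)(\sigma)=\frac1d\sum_{\sigma'\sim\sigma}\frac{f(\sigma')}{\deg\sigma'},$$ where $\sigma\sim\sigma'$ means that $\sigma$ and the reversal $\overline{\sigma'}$ are two different faces, with the induced orientations, of one oriented $d$-cell. The distance of two $(d-1)$-cells is the minimal length of a chain as above joining them. The ball $B_r(X,\sigma)$ around a $(d-1)$-cell $\sigma$ is the subcomplex formed by the $(d-1)$- and $d$-cells all of whose $(d-1)$-faces have distance at most $r$ from $\sigma$, together with all their faces. The distance of marked complexes $(X,\sigma),(X',\sigma')$ is the infimum of the numbers $\frac1{r+1}$ over the integers $r\ge 0$ for which $B_r(X,\sigma)$ and $B_r(X',\sigma')$ are isomorphic as simplicial complexes by an isomorphism taking $\sigma$ to $\sigma'$. For $d$-complexes $X_n$ ($n\in\mathbb N$) and $X$ we write $X_n\to X$ if the degrees of the $(d-1)$-cells of all the $X_n$ are bounded by one constant and $(X_n,\sigma_n)$ converges to $(X,\sigma)$ in this distance for some choice of $(d-1)$-cells $\sigma_n$ of $X_n$ and $\sigma$ of $X$. **Theorem.** Suppose $X_n\to X$. 1.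 For every $\lambda\in\operatorname{Spec}A(X,0)$ there are $\lambda_n\in\operatorname{Spec}A(X_n,0)$, for all $n$, with $\lim_{n\to\infty}\lambda_n=\lambda$. 2. For every $\lambda\in\operatorname{Spec}\Delta^+_X$ there are $\lambda_n\in\operatorname{Spec}\Delta^+_{X_n}$, for all $n$, with $\lim_{n\to\infty}\lambda_n=\lambda$. 3. Consequently $\operatorname{Spec}A(X,0)\subseteq\overline{\bigcup_n\operatorname{Spec}A(X_n,0)}$. -/

import Mathlib

open Filter Topology

/-- A uniform simplicial complex of dimension `d` on a vertex type `V` (vertices of `V` need not all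
belong to the complex): a nonempty family of finite sets, closed under passing to nonempty subsets,
in which every cell lies in a cell of dimension `d` (that is, with `d + 1` vertices), and whose
`(d-1)`-cells have globally bounded degrees. Only nonempty cells are recorded; for `d ≥ 1` the
`(d-1)`- and `d`-cells used below are nonempty. -/
structure UniformComplex (V : Type*) (d : ℕ) extends PreAbstractSimplicialComplex V where
  nonempty : faces.Nonempty
  uniform : ∀ σ ∈ faces, ∃ τ ∈ faces, σ ⊆ τ ∧ τ.card = d + 1
  bounded_degree : ∃ K : ℕ, ∀ σ ∈ faces, σ.card = d →
    {τ | τ ∈ faces ∧ σ ⊆ τ ∧ τ.card = σ.card + 1}.encard ≤ K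

namespace UniformComplex

noncomputable section

variable {V : Type*} {d : ℕ} (X : UniformComplex V d)

/-- The cells of dimension one more containing `σ`. -/
def cofaces (σ : Finset V) : Set (Finset V) :=
  {τ | τ ∈ X.faces ∧ σ ⊆ τ ∧ τ.card = σ.card + 1}

/-- The degree of a cell: the number of cells of dimension one more containing it. -/
def deg (σ : Finset V) : ℕ := (X.cofaces σ).ncard

/-! ### Oriented cells -/

/-- A cell with `n` vertices (so of dimension `n - 1`) together with an ordering of them. -/
def OrderedCell (n : ℕ) : Type _ := {t : Fin n ↪ V // Finset.univ.map t ∈ X.faces}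

/-- Signed ordered cells `s [t₀, …, tₙ₋₁]` are identified when the orderings differ by a
permutation whose signature is the quotient of the signs. -/
def orientedSetoid (n : ℕ) : Setoid (X.OrderedCell n × ℤˣ) where
  r a b := ∃ π : Equiv.Perm (Fin n),
    b.1.1 = π.toEmbedding.trans a.1.1 ∧ b.2 = Equiv.Perm.sign π * a.2
  iseqv := by
    refine ⟨fun a => ⟨1, ?_, by simp⟩, ?_, ?_⟩
    · ext i; rfl
    · rintro a b ⟨π, h1, h2⟩
      refine ⟨π⁻¹, ?_, ?_⟩
      · ext i; simp [h1]
      · rw [h2, ← mul_assoc]; simp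
    · rintro a b c ⟨π, h1, h2⟩ ⟨ρ, h3, h4⟩
      refine ⟨π * ρ, ?_, ?_⟩
      · ext i; simp [h1, h3]
      · rw [h4, h2, ← mul_assoc, Equiv.Perm.sign_mul, mul_comm (Equiv.Perm.sign ρ)]

/-- Oriented cells with `n` vertices. Every cell has exactly two orientations. For `n ≥ 2` these are
the orderings up to even permutations; for `n = 1` these are the formal `+v` and `-v`, so that
antisymmetric functions on them are the same as functions on the vertices. -/
def OrientedCell (n : ℕ) : Type _ := Quotient (X.orientedSetoid n)

variable {X}

/-- The oriented cell `s [t₀, …, tₙ₋₁]`. -/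
def OrientedCell.mk {n : ℕ} (t : X.OrderedCell n) (s : ℤˣ) : X.OrientedCell n :=
  Quotient.mk (X.orientedSetoid n) (t, s)

/-- Reversal of the orientation. -/
def OrientedCell.flip {n : ℕ} : X.OrientedCell n → X.OrientedCell n :=
  Quotient.map' (fun a => (a.1, -a.2)) (by
    rintro a b ⟨π, h1, h2⟩
    exact ⟨π, h1, by simp [h2]⟩)

/-- The underlying (unoriented) cell. -/
def OrientedCell.support {n : ℕ} : X.OrientedCell n → Finset V :=
  Quotient.lift (fun a => Finset.univ.map a.1.1) (by
    rintro a b ⟨π, h1, h2⟩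
    ext v
    simp only [Finset.mem_map, Finset.mem_univ, true_and, h1]
    constructor
    · rintro ⟨i, rfl⟩; exact ⟨π.symm i, by simp⟩
    · rintro ⟨i, rfl⟩; exact ⟨π i, by simp⟩)

/-- `IsFace σ τ`: the oriented cell `σ` is a face of the oriented cell `τ`, with the orientation
induced by it; i.e. for some representation `τ = s [t₀, …, tₙ]` and some `i` one has
`σ = (-1)^i s [t₀, …, tᵢ₋₁, tᵢ₊₁, …, tₙ]`. -/
def IsFace {n : ℕ} (σ : X.OrientedCell n) (τ : X.OrientedCell (n + 1)) : Prop :=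
  ∃ (t : X.OrderedCell (n + 1)) (s : ℤˣ) (t' : X.OrderedCell n) (i : Fin (n + 1)),
    τ = OrientedCell.mk t s ∧ t'.1 = (Fin.succAboveEmb i).trans t.1 ∧
      σ = OrientedCell.mk t' ((-1) ^ (i : ℕ) * s)

/-- Neighbouring oriented cells: `σ` and the reversal of `σ'` are two different faces, with the
induced orientations, of one oriented cell of dimension one more. -/
def Neighbor {n : ℕ} (σ σ' : X.OrientedCell n) : Prop :=
  σ'.flip ≠ σ ∧ ∃ τ : X.OrientedCell (n + 1), IsFace σ τ ∧ IsFace σ'.flip τ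

/-! ### Basic facts about oriented cells -/

theorem OrientedCell.flip_flip {n : ℕ} (σ : X.OrientedCell n) : σ.flip.flip = σ := by
  induction σ using Quotient.inductionOn with
  | h a => exact congrArg (Quotient.mk (X.orientedSetoid n)) (by ext <;> simp)

theorem OrientedCell.flip_mk {n : ℕ} (t : X.OrderedCell n) (s : ℤˣ) :
    (OrientedCell.mk t s).flip = OrientedCell.mk t (-s) := rfl

theorem OrientedCell.support_flip {n : ℕ} (σ : X.OrientedCell n) :
    σ.flip.support = σ.support := by
  induction σ using Quotient.inductionOn with
  | h a => rfl

theorem OrientedCell.support_mem {n : ℕ} (σ : X.OrientedCell n) : σ.support ∈ X.faces := by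
  induction σ using Quotient.inductionOn with
  | h a => exact a.1.2

theorem OrientedCell.card_support {n : ℕ} (σ : X.OrientedCell n) : σ.support.card = n := by
  induction σ using Quotient.inductionOn with
  | h a => exact (Finset.card_map _).trans (by simp)

theorem OrientedCell.eq_or_eq_flip {n : ℕ} {σ σ' : X.OrientedCell n}
    (h : σ.support = σ'.support) : σ' = σ ∨ σ' = σ.flip := by
  induction σ using Quotient.inductionOn with
  | h a =>
  induction σ' using Quotient.inductionOn with
  | h b =>
  obtain ⟨t, s⟩ := a
  obtain ⟨t', s'⟩ := b
  have hs : Finset.univ.map t.1 = Finset.univ.map t'.1 := h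
  have hex : ∀ i, ∃ j, t.1 j = t'.1 i := by
    intro i
    have : t'.1 i ∈ Finset.univ.map t.1 := by rw [hs]; simp
    simpa using this
  choose g hg using hex
  have hginj : Function.Injective g := by
    intro i j hij
    apply t'.1.injective
    rw [← hg, ← hg, hij]
  let π : Equiv.Perm (Fin n) := Equiv.ofBijective g (Finite.injective_iff_bijective.mp hginj)
  have ht : t'.1 = π.toEmbedding.trans t.1 := by
    ext i
    exact (hg i).symm
  rcases Int.units_eq_one_or (s' * (Equiv.Perm.sign π * s)) with h1 | h1
  · left
    refine (Quotient.sound (s := X.orientedSetoid n) ⟨π, ht, ?_⟩).symm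
    exact (Int.units_inv_eq_self s' ▸ (mul_eq_one_iff_inv_eq.mp h1))
  · right
    refine (Quotient.sound (s := X.orientedSetoid n) (a := (t, -s)) ⟨π, ht, ?_⟩).symm
    have h2 : s' * (Equiv.Perm.sign π * -s) = 1 := by
      rw [mul_neg, mul_neg, h1, neg_neg]
    exact (Int.units_inv_eq_self s' ▸ (mul_eq_one_iff_inv_eq.mp h2))

theorem IsFace.flip {n : ℕ} {σ : X.OrientedCell n} {τ : X.OrientedCell (n + 1)}
    (h : IsFace σ τ) : IsFace σ.flip τ.flip := by
  obtain ⟨t, s, t', i, rfl, h2, rfl⟩ := h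
  refine ⟨t, -s, t', i, rfl, h2, ?_⟩
  rw [OrientedCell.flip_mk, mul_neg]

theorem IsFace.support_subset {n : ℕ} {σ : X.OrientedCell n} {τ : X.OrientedCell (n + 1)}
    (h : IsFace σ τ) : σ.support ⊆ τ.support := by
  obtain ⟨t, s, t', i, rfl, h2, rfl⟩ := h
  intro v hv
  change v ∈ Finset.univ.map t'.1 at hv
  change v ∈ Finset.univ.map t.1
  rw [h2] at hv
  simp only [Finset.mem_map, Finset.mem_univ, true_and] at hv ⊢
  obtain ⟨j, rfl⟩ := hv
  exact ⟨_, rfl⟩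

theorem Neighbor.flip {n : ℕ} {σ σ' : X.OrientedCell n}
    (h : Neighbor σ σ') : Neighbor σ.flip σ'.flip := by
  obtain ⟨hne, τ, h1, h2⟩ := h
  exact ⟨fun e => hne (by rw [← OrientedCell.flip_flip σ, ← e, OrientedCell.flip_flip]),
    τ.flip, h1.flip, h2.flip⟩

/-- Two oriented cells whose supports lie in a common `d`-cell. -/
def Close {m n : ℕ} (a : X.OrientedCell m) (b : X.OrientedCell n) : Prop :=
  ∃ τ ∈ X.faces, τ.card = d + 1 ∧ a.support ⊆ τ ∧ b.support ⊆ τ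

theorem Close.symm {m n : ℕ} {a : X.OrientedCell m} {b : X.OrientedCell n}
    (h : Close a b) : Close b a := by
  obtain ⟨τ, h1, h2, h3, h4⟩ := h
  exact ⟨τ, h1, h2, h4, h3⟩

theorem IsFace.close {σ : X.OrientedCell d} {τ : X.OrientedCell (d + 1)} (h : IsFace σ τ) :
    Close σ τ :=
  ⟨τ.support, τ.support_mem, τ.card_support, h.support_subset, subset_rfl⟩

theorem Neighbor.close {σ σ' : X.OrientedCell d} (h : Neighbor σ σ') : Close σ σ' := by
  obtain ⟨-, τ, h1, h2⟩ := h
  refine ⟨τ.support, τ.support_mem, τ.card_support, h1.support_subset, ?_⟩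
  rw [← σ'.support_flip]
  exact h2.support_subset

variable (X)

open Classical in
theorem exists_close_bound (m n : ℕ) (hn : d ≤ n) : ∃ N : ℕ, ∀ b : X.OrientedCell n,
    ∃ S : Finset (X.OrientedCell m), S.card ≤ N ∧ ∀ a, Close a b → a ∈ S := by
  obtain ⟨K, hK⟩ := X.bounded_degree
  refine ⟨(K + 1) * 2 ^ (d + 1) * 2, fun b => ?_⟩
  have h1 : {τ | τ ∈ X.faces ∧ τ.card = d + 1 ∧ b.support ⊆ τ}.encard ≤ (K + 1 : ℕ) := by
    rcases hn.eq_or_lt with h | h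
    · subst h
      refine (Set.encard_le_encard ?_).trans
        ((hK b.support b.support_mem b.card_support).trans (by exact_mod_cast Nat.le_succ K))
      rintro τ ⟨h1, h2, h3⟩
      exact ⟨h1, h3, by rw [h2, b.card_support]⟩
    · refine (Set.encard_le_encard (t := {b.support}) ?_).trans ?_
      · rintro τ ⟨h1, h2, h3⟩
        exact (Finset.eq_of_subset_of_card_le h3 (by rw [h2, b.card_support]; omega)).symm
      · rw [Set.encard_singleton]; exact_mod_cast Nat.succ_le_succ (Nat.zero_le K)
  have hfin : {τ | τ ∈ X.faces ∧ τ.card = d + 1 ∧ b.support ⊆ τ}.Finite :=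
    Set.finite_of_encard_le_coe h1
  rw [hfin.encard_eq_coe_toFinset_card] at h1
  have h1' : hfin.toFinset.card ≤ K + 1 := by exact_mod_cast h1
  let fib : Finset V → Finset (X.OrientedCell m) := fun s =>
    if h : ∃ a : X.OrientedCell m, a.support = s then {h.choose, h.choose.flip} else ∅
  have hfib : ∀ s, (fib s).card ≤ 2 := by
    intro s
    by_cases h : ∃ a : X.OrientedCell m, a.support = s
    · simp only [fib, dif_pos h]; exact Finset.card_le_two
    · simp only [fib, dif_neg h]; simp
  refine ⟨(hfin.toFinset.biUnion Finset.powerset).biUnion fib, ?_, ?_⟩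
  · refine (Finset.card_biUnion_le_card_mul _ _ 2 fun s _ => hfib s).trans ?_
    gcongr
    refine (Finset.card_biUnion_le_card_mul _ _ (2 ^ (d + 1)) ?_).trans ?_
    · intro τ hτ
      rw [Finset.card_powerset, (hfin.mem_toFinset.mp hτ).2.1]
    · gcongr
  · rintro a ⟨τ, hτ, hc, ha, hb⟩
    simp only [Finset.mem_biUnion, Finset.mem_powerset]
    refine ⟨a.support, ⟨τ, hfin.mem_toFinset.mpr ⟨hτ, hc, hb⟩, ha⟩, ?_⟩
    have h : ∃ a' : X.OrientedCell m, a'.support = a.support := ⟨a, rfl⟩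
    simp only [fib, dif_pos h, Finset.mem_insert, Finset.mem_singleton]
    exact OrientedCell.eq_or_eq_flip h.choose_spec

/-! ### Forms -/

/-- The weight of a cell: `1 / deg σ` for the `(d-1)`-cells and `1` for the others. -/
def weight (σ : Finset V) : ℝ := if σ.card = d then 1 / (X.deg σ : ℝ) else 1

/-- The weights are bounded above by `1` and bounded away from `0`. -/
theorem weight_bounds : ∃ K : ℝ, 0 ≤ K ∧ ∀ σ ∈ X.faces,
    0 < X.weight σ ∧ X.weight σ ≤ 1 ∧ 1 ≤ K * X.weight σ := by
  obtain ⟨K, hK⟩ := X.bounded_degree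
  refine ⟨K + 1, by positivity, fun σ hσ => ?_⟩
  unfold weight
  split_ifs with h
  · have hb : (X.cofaces σ).encard ≤ K := hK σ hσ h
    have hfin : (X.cofaces σ).Finite := Set.finite_of_encard_le_coe hb
    have hne : (X.cofaces σ).Nonempty := by
      obtain ⟨τ, h1, h2, h3⟩ := X.uniform σ hσ
      exact ⟨τ, h1, h2, by rw [h3, h]⟩
    have h1 : 1 ≤ X.deg σ := (Set.ncard_pos hfin).mpr hne
    have h2 : X.deg σ ≤ K := by
      rw [← hfin.cast_ncard_eq] at hb
      exact_mod_cast hb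
    have h1' : (1 : ℝ) ≤ X.deg σ := by exact_mod_cast h1
    have h2' : (X.deg σ : ℝ) ≤ K := by exact_mod_cast h2
    refine ⟨by positivity, ?_, ?_⟩
    · rw [div_le_one (by linarith)]; exact h1'
    · rw [mul_one_div, le_div_iff₀ (by linarith)]; linarith
  · exact ⟨one_pos, le_rfl, by simp⟩

/-- The space `Ω^{n-1}` of forms: antisymmetric functions on the oriented cells with `n`
vertices. -/
def Omega (n : ℕ) : Submodule ℝ (X.OrientedCell n → ℝ) where
  carrier := {f | ∀ σ, f σ.flip = -f σ}
  add_mem' := by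
    intro f g hf hg σ
    simp [hf σ, hg σ, add_comm]
  zero_mem' := by intro σ; simp
  smul_mem' := by
    intro c f hf σ
    simp [hf σ]

/-- The subspace of square summable forms, with respect to the weights. -/
def OmegaL2Submodule (n : ℕ) : Submodule ℝ (X.OrientedCell n → ℝ) where
  carrier := {f | f ∈ X.Omega n ∧ Summable fun σ => X.weight σ.support * f σ ^ 2}
  add_mem' := by
    rintro f g ⟨hf, hf2⟩ ⟨hg, hg2⟩
    refine ⟨add_mem hf hg, ?_⟩
    obtain ⟨K, -, hK⟩ := X.weight_bounds
    refine Summable.of_nonneg_of_le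
      (fun σ => mul_nonneg (hK _ σ.support_mem).1.le (sq_nonneg _)) (fun σ => ?_)
      ((hf2.add hg2).mul_left 2)
    have hw := (hK _ σ.support_mem).1.le
    have h3 : (f σ + g σ) ^ 2 ≤ 2 * (f σ ^ 2 + g σ ^ 2) := by nlinarith [sq_nonneg (f σ - g σ)]
    calc X.weight σ.support * (f + g) σ ^ 2
        ≤ X.weight σ.support * (2 * (f σ ^ 2 + g σ ^ 2)) := mul_le_mul_of_nonneg_left h3 hw
      _ = _ := by ring
  zero_mem' := ⟨zero_mem _, by simp⟩
  smul_mem' := by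
    rintro c f ⟨hf, hf2⟩
    refine ⟨Submodule.smul_mem _ c hf, ?_⟩
    refine (hf2.mul_left (c ^ 2)).congr fun σ => ?_
    change _ = _ * (c * f σ) ^ 2
    ring

/-- The space `Ω^{n-1}_{L²}` of square summable forms. -/
def OmegaL2 (n : ℕ) : Type _ := X.OmegaL2Submodule n

instance (n : ℕ) : AddCommGroup (X.OmegaL2 n) :=
  inferInstanceAs (AddCommGroup (X.OmegaL2Submodule n))

instance (n : ℕ) : Module ℝ (X.OmegaL2 n) :=
  inferInstanceAs (Module ℝ (X.OmegaL2Submodule n))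

instance (n : ℕ) : CoeFun (X.OmegaL2 n) (fun _ => X.OrientedCell n → ℝ) := ⟨fun f => f.1⟩

theorem OmegaL2.summable_mul {n : ℕ} (f g : X.OmegaL2 n) :
    Summable fun σ => X.weight σ.support * (f σ * g σ) := by
  obtain ⟨K, -, hK⟩ := X.weight_bounds
  refine Summable.of_norm_bounded (f.2.2.add g.2.2) fun σ => ?_
  have hw := (hK _ σ.support_mem).1.le
  rw [Real.norm_eq_abs, abs_mul, abs_of_nonneg hw, ← mul_add]
  refine mul_le_mul_of_nonneg_left ?_ hw
  rw [abs_le]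
  constructor <;> nlinarith [sq_nonneg (f.1 σ - g.1 σ), sq_nonneg (f.1 σ + g.1 σ)]

/-- The inner product `⟨f, g⟩ = ∑ w(σ) f(σ) g(σ)` over the unoriented cells; since the sum below
runs over the oriented cells, it counts every cell twice. -/
instance omegaL2Core (n : ℕ) : InnerProductSpace.Core ℝ (X.OmegaL2 n) where
  inner f g := (1 / 2) * ∑' σ : X.OrientedCell n, X.weight σ.support * (f σ * g σ)
  conj_inner_symm f g := by simp [mul_comm]
  re_inner_nonneg f := by
    obtain ⟨K, -, hK⟩ := X.weight_bounds
    exact mul_nonneg (by norm_num)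
      (tsum_nonneg fun σ => mul_nonneg (hK _ σ.support_mem).1.le (mul_self_nonneg _))
  add_left f g h := by
    rw [← mul_add, ← Summable.tsum_add (OmegaL2.summable_mul X f h) (OmegaL2.summable_mul X g h)]
    congr 1
    refine tsum_congr fun σ => ?_
    change _ * ((f.1 σ + g.1 σ) * _) = _
    ring
  smul_left f g r := by
    simp only [conj_trivial]
    rw [mul_left_comm r, ← tsum_mul_left (a := r)]
    refine congrArg (fun x : ℝ => (1 / 2) * x) (tsum_congr fun σ => ?_)
    change _ * ((r * f.1 σ) * _) = _
    ring
  definite f hf := by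
    obtain ⟨K, -, hK⟩ := X.weight_bounds
    have h0 : ∑' σ : X.OrientedCell n, X.weight σ.support * (f σ * f σ) = 0 := by
      have : (1 / 2 : ℝ) * ∑' σ : X.OrientedCell n, X.weight σ.support * (f σ * f σ) = 0 := hf
      linarith
    have h1 : HasSum (fun σ : X.OrientedCell n => X.weight σ.support * (f σ * f σ)) 0 :=
      h0 ▸ (OmegaL2.summable_mul X f f).hasSum
    have hnn : ∀ σ : X.OrientedCell n, 0 ≤ X.weight σ.support * (f σ * f σ) :=
      fun σ => mul_nonneg (hK _ σ.support_mem).1.le (mul_self_nonneg _)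
    replace h1 := (hasSum_zero_iff_of_nonneg hnn).mp h1
    refine Subtype.ext (funext fun σ => ?_)
    have h2 := congrFun h1 σ
    rcases mul_eq_zero.mp h2 with h3 | h3
    · exact absurd h3 (hK _ σ.support_mem).1.ne'
    · exact mul_self_eq_zero.mp h3

instance (n : ℕ) : NormedAddCommGroup (X.OmegaL2 n) :=
  (X.omegaL2Core n).toNormedAddCommGroup

instance (n : ℕ) : InnerProductSpace ℝ (X.OmegaL2 n) :=
  InnerProductSpace.ofCore (X.omegaL2Core n).toCore

theorem OmegaL2.norm_sq {n : ℕ} (f : X.OmegaL2 n) :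
    ‖f‖ ^ 2 = (1 / 2) * ∑' σ : X.OrientedCell n, X.weight σ.support * f σ ^ 2 := by
  rw [← real_inner_self_eq_norm_sq]
  change (1 / 2) * ∑' σ : X.OrientedCell n, X.weight σ.support * (f σ * f σ) = _
  simp only [pow_two]

/-! ### Operators -/

open scoped ENNReal in
open Classical in
/-- Operators given by sums over a relation with finite rows and columns are bounded. -/
theorem kernel_bound {α β : Type*} (R : α → β → Prop) (M N : ℕ) (K : ℝ) (hK : 0 ≤ K)
    (u c : α → ℝ) (w : β → ℝ) (hu : ∀ a, 1 ≤ K * u a) (hc : ∀ a, |c a| ≤ 1)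
    (hw0 : ∀ b, 0 ≤ w b) (hw1 : ∀ b, w b ≤ 1)
    (hM : ∀ b, ∃ S : Finset α, S.card ≤ M ∧ ∀ a, R a b → a ∈ S)
    (hN : ∀ a, ∃ S : Finset β, S.card ≤ N ∧ ∀ b, R a b → b ∈ S)
    (f : α → ℝ) (hf : Summable fun a => u a * f a ^ 2) :
    (Summable fun b => w b * (∑ᶠ a ∈ {a | R a b}, c a * f a) ^ 2) ∧
      ∑' b, w b * (∑ᶠ a ∈ {a | R a b}, c a * f a) ^ 2 ≤ M * N * K * ∑' a, u a * f a ^ 2 := by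
  have hu0 : ∀ a, 0 ≤ u a := fun a => by
    by_contra h
    have := mul_nonpos_of_nonneg_of_nonpos hK (not_le.mp h).le
    linarith [hu a]
  have hpt : ∀ b, w b * (∑ᶠ a ∈ {a | R a b}, c a * f a) ^ 2 ≤
      M * K * ∑' a, if R a b then u a * f a ^ 2 else 0 := by
    intro b
    obtain ⟨S, hS, hSR⟩ := hM b
    have e1 : ∑ᶠ a ∈ {a | R a b}, c a * f a = ∑ a ∈ S.filter (fun a => R a b), c a * f a := by
      have hset : {a | R a b} = ((S.filter fun a => R a b : Finset α) : Set α) := by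
        ext a
        rw [Finset.mem_coe, Finset.mem_filter]
        exact ⟨fun h => ⟨hSR a h, h⟩, fun h => h.2⟩
      rw [hset, finsum_mem_coe_finset]
    have e2 : ∑' a, (if R a b then u a * f a ^ 2 else 0) =
        ∑ a ∈ S.filter (fun a => R a b), u a * f a ^ 2 := by
      rw [Finset.sum_filter]
      refine tsum_eq_sum fun a ha => if_neg fun h => ha (hSR a h)
    rw [e1, e2]
    have h1 := sq_sum_le_card_mul_sum_sq (s := S.filter (fun a => R a b))
      (f := fun a => c a * f a)
    have hcard : ((S.filter (fun a => R a b)).card : ℝ) ≤ M := by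
      exact_mod_cast (Finset.card_filter_le _ _).trans hS
    have h2 : ∑ a ∈ S.filter (fun a => R a b), (c a * f a) ^ 2 ≤
        K * ∑ a ∈ S.filter (fun a => R a b), u a * f a ^ 2 := by
      rw [Finset.mul_sum]
      refine Finset.sum_le_sum fun a _ => ?_
      have h3 : c a ^ 2 ≤ 1 := by
        rw [← sq_abs]; exact pow_le_one₀ (abs_nonneg _) (hc a)
      rw [mul_pow, ← mul_assoc]
      exact mul_le_mul_of_nonneg_right (h3.trans (hu a)) (sq_nonneg _)
    calc w b * (∑ a ∈ S.filter (fun a => R a b), c a * f a) ^ 2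
        ≤ 1 * (∑ a ∈ S.filter (fun a => R a b), c a * f a) ^ 2 :=
          mul_le_mul_of_nonneg_right (hw1 b) (sq_nonneg _)
      _ ≤ M * (K * ∑ a ∈ S.filter (fun a => R a b), u a * f a ^ 2) := by
          rw [one_mul]
          exact h1.trans (mul_le_mul hcard h2
            (Finset.sum_nonneg fun _ _ => sq_nonneg _) (Nat.cast_nonneg _))
      _ = _ := by ring
  -- the double sum, first by rows, then by columns
  have hprod : Summable fun p : α × β => if R p.1 p.2 then u p.1 * f p.1 ^ 2 else 0 := by
    have hcol : ∀ a, ∃ S : Finset β, S.card ≤ N ∧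
        ∀ b, b ∉ S → (if R a b then u a * f a ^ 2 else 0) = 0 := fun a => by
      obtain ⟨S, hS, hSR⟩ := hN a
      exact ⟨S, hS, fun b hb => if_neg fun h => hb (hSR b h)⟩
    rw [summable_prod_of_nonneg]
    · refine ⟨fun a => ?_, ?_⟩
      · obtain ⟨S, -, h⟩ := hcol a
        exact summable_of_ne_finset_zero (s := S) h
      · refine Summable.of_nonneg_of_le (fun a => tsum_nonneg fun b => ?_) (fun a => ?_)
          (hf.mul_left (N : ℝ))
        · change 0 ≤ if R a b then u a * f a ^ 2 else 0
          split_ifs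
          · exact mul_nonneg (hu0 a) (sq_nonneg _)
          · exact le_rfl
        · obtain ⟨S, hS, h⟩ := hcol a
          change ∑' b, (if R a b then u a * f a ^ 2 else 0) ≤ _
          rw [tsum_eq_sum (s := S) h]
          refine (Finset.sum_le_card_nsmul _ _ (u a * f a ^ 2) fun b _ => ?_).trans ?_
          · split_ifs
            · exact le_rfl
            · exact mul_nonneg (hu0 a) (sq_nonneg _)
          · rw [nsmul_eq_mul]
            exact mul_le_mul_of_nonneg_right (by exact_mod_cast hS)
              (mul_nonneg (hu0 a) (sq_nonneg _))
    · intro p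
      dsimp only [Pi.zero_apply]
      split_ifs
      · exact mul_nonneg (hu0 _) (sq_nonneg _)
      · exact le_rfl
  have hswap : Summable fun p : β × α => if R p.2 p.1 then u p.2 * f p.2 ^ 2 else 0 :=
    hprod.prod_symm
  have hsb : Summable fun b => M * K * ∑' a, if R a b then u a * f a ^ 2 else 0 :=
    hswap.prod.mul_left _
  have hs := Summable.of_nonneg_of_le (fun b => mul_nonneg (hw0 b) (sq_nonneg _)) hpt hsb
  refine ⟨hs, (hs.tsum_le_tsum hpt hsb).trans ?_⟩
  rw [tsum_mul_left, hprod.tsum_comm]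
  have hMK : (0 : ℝ) ≤ M * K := mul_nonneg (Nat.cast_nonneg _) hK
  have hle : ∑' a, ∑' b, (if R a b then u a * f a ^ 2 else 0) ≤ N * ∑' a, u a * f a ^ 2 := by
    rw [← tsum_mul_left]
    refine hprod.prod.tsum_le_tsum (fun a => ?_) (hf.mul_left _)
    obtain ⟨S, hS, hSR⟩ := hN a
    change ∑' b, (if R a b then u a * f a ^ 2 else 0) ≤ _
    rw [tsum_eq_sum (s := S) (fun b hb => if_neg fun h => hb (hSR b h))]
    refine (Finset.sum_le_card_nsmul _ _ (u a * f a ^ 2) fun b _ => ?_).trans ?_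
    · split_ifs
      · exact le_rfl
      · exact mul_nonneg (hu0 a) (sq_nonneg _)
    · rw [nsmul_eq_mul]
      exact mul_le_mul_of_nonneg_right (by exact_mod_cast hS)
        (mul_nonneg (hu0 a) (sq_nonneg _))
  calc _ ≤ M * K * (N * ∑' a, u a * f a ^ 2) := mul_le_mul_of_nonneg_left hle hMK
    _ = _ := by ring

/-- The bounded operator `(T f)(b) = ∑ c(a) f(a)`, the (finite) sum being over the oriented cells `a`
with `R a b`, for a local relation `R` invariant under the reversal of both orientations. -/
def kernelOperator {m n : ℕ} (hm : d ≤ m) (hn : d ≤ n)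
    (R : X.OrientedCell m → X.OrientedCell n → Prop) (c : Finset V → ℝ)
    (hR : ∀ a b, R a b → R a.flip b.flip) (hclose : ∀ a b, R a b → Close a b)
    (hc : ∀ σ ∈ X.faces, |c σ| ≤ 1) : X.OmegaL2 m →L[ℝ] X.OmegaL2 n :=
  have hbound : ∃ C : ℝ, 0 ≤ C ∧ ∀ f : X.OmegaL2 m,
      (Summable fun b : X.OrientedCell n =>
        X.weight b.support * (∑ᶠ a ∈ {a | R a b}, c a.support * f a) ^ 2) ∧
      ∑' b : X.OrientedCell n,
        X.weight b.support * (∑ᶠ a ∈ {a | R a b}, c a.support * f a) ^ 2 ≤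
        C * ∑' a : X.OrientedCell m, X.weight a.support * f a ^ 2 := by
    obtain ⟨K, hK0, hK⟩ := X.weight_bounds
    obtain ⟨M, hM⟩ := X.exists_close_bound m n hn
    obtain ⟨N, hN⟩ := X.exists_close_bound n m hm
    refine ⟨M * N * K, by positivity, fun f => ?_⟩
    refine kernel_bound R M N K hK0 (fun a => X.weight a.support) (fun a => c a.support)
      (fun b => X.weight b.support) (fun a => (hK _ a.support_mem).2.2)
      (fun a => hc _ a.support_mem) (fun b => (hK _ b.support_mem).1.le)
      (fun b => (hK _ b.support_mem).2.1) (fun b => ?_) (fun a => ?_) f.1 f.2.2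
    · obtain ⟨S, hS, h⟩ := hM b
      exact ⟨S, hS, fun a ha => h a (hclose a b ha)⟩
    · obtain ⟨S, hS, h⟩ := hN a
      exact ⟨S, hS, fun b hb => h b (hclose a b hb).symm⟩
  have hfin : ∀ b : X.OrientedCell n, {a | R a b}.Finite := fun b => by
    obtain ⟨M, hM⟩ := X.exists_close_bound m n hn
    obtain ⟨S, -, h⟩ := hM b
    exact S.finite_toSet.subset fun a ha => h a (hclose a b ha)
  LinearMap.mkContinuousOfExistsBound
    { toFun := fun f => ⟨fun b => ∑ᶠ a ∈ {a | R a b}, c a.support * f a, by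
        refine ⟨fun b => ?_, (hbound.choose_spec.2 f).1⟩
        rw [← finsum_mem_neg_distrib _ (hfin b)]
        refine finsum_mem_eq_of_bijOn OrientedCell.flip ⟨?_, ?_, ?_⟩ ?_
        · intro a ha
          have := hR _ _ ha
          rwa [OrientedCell.flip_flip] at this
        · intro a _ a' _ h
          rw [← a.flip_flip, h, a'.flip_flip]
        · intro a ha
          exact ⟨a.flip, hR _ _ ha, a.flip_flip⟩
        · intro a _
          rw [OrientedCell.support_flip, f.2.1 a]; ring⟩
      map_add' := fun f g => by
        refine Subtype.ext (funext fun b => ?_)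
        change ∑ᶠ a ∈ {a | R a b}, c a.support * (f.1 a + g.1 a) =
          (∑ᶠ a ∈ {a | R a b}, c a.support * f.1 a) + ∑ᶠ a ∈ {a | R a b}, c a.support * g.1 a
        rw [← finsum_mem_add_distrib (hfin b)]
        exact finsum_mem_congr rfl fun a _ => mul_add _ _ _
      map_smul' := fun r f => by
        refine Subtype.ext (funext fun b => ?_)
        change ∑ᶠ a ∈ {a | R a b}, c a.support * (r * f.1 a) =
          r * ∑ᶠ a ∈ {a | R a b}, c a.support * f.1 a
        rw [← smul_eq_mul, smul_finsum_mem (hfin b)]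
        exact finsum_mem_congr rfl fun a _ => by rw [smul_eq_mul]; ring }
    (by
      obtain ⟨C, hC, h⟩ := hbound
      refine ⟨Real.sqrt C, fun f => ?_⟩
      rw [← sq_le_sq₀ (norm_nonneg _) (by positivity), mul_pow, Real.sq_sqrt hC,
        OmegaL2.norm_sq, OmegaL2.norm_sq]
      have := (h f).2
      calc _ ≤ (1 / 2) * (C * ∑' a : X.OrientedCell m, X.weight a.support * f a ^ 2) :=
            mul_le_mul_of_nonneg_left this (by norm_num)
        _ = _ := by ring)

theorem kernelOperator_apply {m n : ℕ} (hm : d ≤ m) (hn : d ≤ n)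
    (R : X.OrientedCell m → X.OrientedCell n → Prop) (c : Finset V → ℝ)
    (hR : ∀ a b, R a b → R a.flip b.flip) (hclose : ∀ a b, R a b → Close a b)
    (hc : ∀ σ ∈ X.faces, |c σ| ≤ 1) (f : X.OmegaL2 m) (b : X.OrientedCell n) :
    X.kernelOperator hm hn R c hR hclose hc f b = ∑ᶠ a ∈ {a | R a b}, c a.support * f a := by
  rw [kernelOperator]
  rfl

theorem abs_one_div_deg_le (σ : Finset V) : |1 / (X.deg σ : ℝ)| ≤ 1 := by
  rw [abs_of_nonneg (by positivity)]
  rcases Nat.eq_zero_or_pos (X.deg σ) with h | h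
  · simp [h]
  · rw [div_le_one (by exact_mod_cast h)]; exact_mod_cast h

/-- The boundary operator `∂_d : Ω^d → Ω^{d-1}`, `(∂F)(σ) = ∑_{v ◁ σ} F(vσ)`; the cells `vσ` are
exactly the oriented `d`-cells which have `σ` as a face with the induced orientation. -/
def boundary : X.OmegaL2 (d + 1) →L[ℝ] X.OmegaL2 d :=
  X.kernelOperator (Nat.le_succ d) le_rfl (fun τ σ => IsFace σ τ) (fun _ => 1)
    (fun _ _ h => h.flip)
    (fun _ _ h => h.close.symm)
    (fun _ _ => by simp)

/-- The coboundary operator `δ_d : Ω^{d-1} → Ω^d`,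
`(δf)(τ) = ∑ᵢ (-1)^i f(τ \ τᵢ) / deg (τ \ τᵢ)`, i.e. the sum of `f(σ) / deg σ` over the faces `σ` of
`τ` with the induced orientations. -/
def coboundary : X.OmegaL2 d →L[ℝ] X.OmegaL2 (d + 1) :=
  X.kernelOperator le_rfl (Nat.le_succ d) (fun σ τ => IsFace σ τ) (fun σ => 1 / (X.deg σ : ℝ))
    (fun _ _ h => h.flip)
    (fun _ _ h => h.close)
    (fun σ _ => X.abs_one_div_deg_le σ)

/-- The upper Laplacian `Δ⁺ = ∂_d δ_d` on `Ω^{d-1}_{L²}`. -/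
def upperLaplacian : X.OmegaL2 d →L[ℝ] X.OmegaL2 d := X.boundary ∘L X.coboundary

/-- The sum `f ↦ (σ ↦ ∑_{σ' ∼ σ} f(σ') / deg σ')` over the neighbours
(the relation `∼` is symmetric). -/
def neighborSum : X.OmegaL2 d →L[ℝ] X.OmegaL2 d :=
  X.kernelOperator le_rfl le_rfl (fun σ' σ => Neighbor σ σ') (fun σ => 1 / (X.deg σ : ℝ))
    (fun _ _ h => h.flip) (fun _ _ h => h.close.symm)
    (fun σ _ => X.abs_one_div_deg_le σ)

/-- The transition operator `A(X, p)` of the `p`-lazy `(d-1)`-walk, acting on `Ω^{d-1}_{L²}`: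
`(A f)(σ) = p f(σ) + ((1 - p) / d) ∑_{σ' ∼ σ} f(σ') / deg σ'`. -/
def transitionOperator (p : ℝ) : X.OmegaL2 d →L[ℝ] X.OmegaL2 d :=
  p • ContinuousLinearMap.id ℝ (X.OmegaL2 d) + ((1 - p) / d) • X.neighborSum

/-! ### Distance, balls and convergence -/

/-- The unoriented `(d-1)`-cells. -/
abbrev Cell : Type _ := {σ : Finset V // σ ∈ X.faces ∧ σ.card = d}

open Classical in
/-- The graph on the `(d-1)`-cells in which `σ, σ'` are adjacent when `σ ∪ σ'` is a `d`-cell. -/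
def cellGraph : SimpleGraph X.Cell where
  Adj σ σ' := σ.1 ∪ σ'.1 ∈ X.faces ∧ (σ.1 ∪ σ'.1).card = d + 1
  symm := ⟨fun σ σ' h => by rwa [Finset.union_comm]⟩
  loopless := ⟨fun σ h => by
    have h2 := h.2
    rw [Finset.union_idempotent, σ.2.2] at h2
    omega⟩

/-- `X` is `(d-1)`-connected: any two `(d-1)`-cells are joined by a chain of `(d-1)`-cells in which
the union of any two consecutive ones is a `d`-cell. -/
def IsConnected : Prop := X.cellGraph.Connected

/-- The cells of the ball of radius `r` around the `(d-1)`-cell `σ`: the cells of dimension at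
least `d - 1` all of whose `(d-1)`-faces are at distance at most `r` from `σ` (the distance being the
minimal length of a chain), together with their faces. -/
def ball (σ : X.Cell) (r : ℕ) : Set (Finset V) :=
  {ρ | ρ.Nonempty ∧ ∃ τ ∈ X.faces, ρ ⊆ τ ∧ d ≤ τ.card ∧
    ∀ σ' : X.Cell, σ'.1 ⊆ τ → X.cellGraph.edist σ σ' ≤ r}

/-- The vertices of a ball. -/
abbrev BallVertex (σ : X.Cell) (r : ℕ) : Type _ := {v : V // {v} ∈ X.ball σ r}

/-- The balls of radius `r` around `σ` and `τ` are isometric, i.e. isomorphic as marked complexes: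
there is a bijection between their vertices taking cells to cells in both directions, and taking
the center `σ` to the center `τ`. -/
def BallIsometric {W : Type*} (X : UniformComplex V d) (σ : X.Cell)
    (Y : UniformComplex W d) (τ : Y.Cell) (r : ℕ) : Prop :=
  ∃ φ : X.BallVertex σ r ≃ Y.BallVertex τ r,
    (∀ s : Finset (X.BallVertex σ r),
      s.map (Function.Embedding.subtype _) ∈ X.ball σ r ↔
        (s.map φ.toEmbedding).map (Function.Embedding.subtype _) ∈ Y.ball τ r) ∧
    ∀ v : X.BallVertex σ r, v.1 ∈ σ.1 ↔ (φ v).1 ∈ τ.1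

/-- The distance between marked complexes. -/
def markedDist {W : Type*} (X : UniformComplex V d) (σ : X.Cell)
    (Y : UniformComplex W d) (τ : Y.Cell) : ℝ :=
  sInf {x : ℝ | ∃ r : ℕ, BallIsometric X σ Y τ r ∧ x = 1 / ((r : ℝ) + 1)}

/-- Convergence `X_n → X`: the `(d-1)`-degrees of the `X_n` are globally bounded, and
`(X_n, σ_n)` converges to `(X, σ)` as marked complexes for some choice of `(d-1)`-cells. -/
def ConvergesTo {V : ℕ → Type*} {W : Type*} (X : ∀ n, UniformComplex (V n) d)
    (Y : UniformComplex W d) : Prop :=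
  (∃ K : ℕ, ∀ n, ∀ σ : (X n).Cell, (X n).deg σ.1 ≤ K) ∧
  ∃ (σ : ∀ n, (X n).Cell) (τ : Y.Cell),
    Tendsto (fun n => markedDist (X n) (σ n) Y τ) atTop (𝓝 0)

end

end UniformComplex

/-! For a symmetric operator, spectral points and approximate eigenvalues are the same up to small
errors. On a complete space every spectral point `l` admits vectors with `‖T f - l f‖ < ε ‖f‖`
(`exists_norm_sub_smul_lt`). Conversely, one nonzero vector with `‖T f - l f‖ ≤ ε ‖f‖` forces a
spectral point within `ε` of `l` (`exists_mem_spectrum_abs_sub_le`), because plus or minus the norm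
of the resolvent lies in the spectrum of the resolvent.

The walk operator and the upper Laplacian are symmetric because their coefficients are the weights
of the inner product (`inner_kernelOperator`), and they are local: they enlarge supports by at most
one and two steps.

Take `l` in the spectrum for the limit complex and an approximate eigenform `f`. Connectedness makes
the balls exhaust the complex, so the restriction of `f` to a large ball still satisfies the strict
inequality (`tendsto_restrictBall`). For large `n` a slightly larger ball is isomorphic to a ball of
the `n`-th complex. Transport along this isomorphism preserves the norm (`norm_pull`) and commutes
with the operators (`kernelOperator_pull`), so the `n`-th operator has an approximate eigenform with
the same `l` and `ε`, and its spectrum comes within `ε` of `l`.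

The delicate point is that distances and degrees are measured in the whole complexes, not in the
balls. An isomorphism of balls respects concentric balls (`image_mem_ball`), and it respects the
degrees of cells at least one step away from the boundary (`deg_image`); this explains the margins
in the radii. -/

/-! ### Spectra and approximate eigenvalues of symmetric operators -/

section SymmetricOperators

variable {E : Type*} [NormedAddCommGroup E] [InnerProductSpace ℝ E]

/-- One of the numbers `±‖R‖` belongs to the spectrum of a symmetric operator `R ≠ 0`. -/
theorem ContinuousLinearMap.norm_mem_spectrum_or_neg_norm_mem_spectrum (R : E →L[ℝ] E)
    (hR : (R : E →ₗ[ℝ] E).IsSymmetric) (hne : R ≠ 0) :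
    ‖R‖ ∈ spectrum ℝ R ∨ -‖R‖ ∈ spectrum ℝ R := by
  set M := ‖R‖ with hM
  have hMpos : 0 < M := norm_pos_iff.mpr hne
  by_contra! h
  obtain ⟨h1, h2⟩ := h
  rw [spectrum.notMem_iff] at h1 h2
  have hu := h1.mul h2
  obtain ⟨u, hu⟩ := hu
  set C := ‖(↑u⁻¹ : E →L[ℝ] E)‖ with hC
  -- If neither `M` nor `-M` is spectral, then `(M - R)(-M - R) = R² - M²` is invertible, hence
  -- bounded below.
  have hlow : ∀ x, ‖x‖ ≤ C * ‖R (R x) - (M * M) • x‖ := by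
    intro x
    have h3 : (↑u⁻¹ : E →L[ℝ] E) ((u : E →L[ℝ] E) x) = x := by
      change ((↑u⁻¹ : E →L[ℝ] E) * (u : E →L[ℝ] E)) x = x
      simp
    have h4 : (u : E →L[ℝ] E) x = R (R x) - (M * M) • x := by
      rw [hu]
      have h5 : ∀ (c : ℝ) (y : E), (algebraMap ℝ (E →L[ℝ] E) c - R) y = c • y - R y :=
        fun c y => by simp [Algebra.algebraMap_eq_smul_one]
      change (algebraMap ℝ (E →L[ℝ] E) M - R) ((algebraMap ℝ (E →L[ℝ] E) (-M) - R) x) = _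
      rw [h5, h5, map_sub, map_smul, smul_sub, smul_smul, neg_smul, mul_neg, neg_smul]
      abel
    calc ‖x‖ = ‖(↑u⁻¹ : E →L[ℝ] E) ((u : E →L[ℝ] E) x)‖ := by rw [h3]
      _ ≤ C * ‖(u : E →L[ℝ] E) x‖ := ContinuousLinearMap.le_opNorm _ _
      _ = _ := by rw [h4]
  have hC0 : 0 ≤ C := norm_nonneg _
  -- Expand the square: symmetry turns the cross term into `‖R x‖²`, and `‖R (R x)‖ ≤ M² ‖x‖`. A
  -- vector on which `R` nearly attains its norm would make the right side small, against `hlow`.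
  have hkey : ∀ x, ‖R (R x) - (M * M) • x‖ ^ 2 ≤ 2 * M ^ 4 * ‖x‖ ^ 2 - 2 * M ^ 2 * ‖R x‖ ^ 2 := by
    intro x
    have h5 : inner ℝ (R (R x)) x = ‖R x‖ ^ 2 := by
      rw [← real_inner_self_eq_norm_sq]
      exact hR (R x) x
    rw [norm_sub_sq_real, inner_smul_right, h5, norm_smul, Real.norm_eq_abs, mul_pow, sq_abs]
    have h6 : ‖R (R x)‖ ≤ M * (M * ‖x‖) :=
      (R.le_opNorm _).trans (mul_le_mul_of_nonneg_left (R.le_opNorm _) hMpos.le)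
    have h7 : ‖R (R x)‖ ^ 2 ≤ (M * (M * ‖x‖)) ^ 2 := pow_le_pow_left₀ (norm_nonneg _) h6 2
    nlinarith
  -- hence `‖R x‖² ≤ q2 ‖x‖²` for some `q2 < M²`
  have hbd : ∀ x, 2 * M ^ 2 * C ^ 2 * ‖R x‖ ^ 2 ≤ (2 * M ^ 4 * C ^ 2 - 1) * ‖x‖ ^ 2 := by
    intro x
    have h8 : ‖x‖ ^ 2 ≤ (C * ‖R (R x) - (M * M) • x‖) ^ 2 :=
      pow_le_pow_left₀ (norm_nonneg _) (hlow x) 2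
    have h9 := mul_le_mul_of_nonneg_left (hkey x) (sq_nonneg C)
    nlinarith
  -- `C = 0` would make the whole space trivial, hence `R = 0`.
  have hCpos : 0 < C := by
    rcases hC0.eq_or_lt with h0 | h0
    · exfalso
      apply hne
      ext x
      have := hlow x
      rw [← h0, zero_mul] at this
      have : x = 0 := norm_le_zero_iff.mp this
      simp [this]
    · exact h0
  set q2 := M ^ 2 - 1 / (2 * M ^ 2 * C ^ 2) with hq2
  have hq : ∀ x, ‖R x‖ ^ 2 ≤ q2 * ‖x‖ ^ 2 := by
    intro x
    have h10 := hbd x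
    have h11 : 0 < 2 * M ^ 2 * C ^ 2 := by positivity
    have h12 : 2 * M ^ 2 * C ^ 2 * q2 = 2 * M ^ 4 * C ^ 2 - 1 := by
      rw [hq2]; field_simp
    refine le_of_mul_le_mul_left ?_ h11
    rw [← mul_assoc, h12]
    exact h10
  -- If `q2 < 0`, then `hq` forces `R x = 0`, so the bound with `sqrt q2 = 0` still holds.
  have hMle : M ≤ Real.sqrt q2 := by
    refine ContinuousLinearMap.opNorm_le_bound _ (Real.sqrt_nonneg _) fun x => ?_
    rcases le_or_gt 0 q2 with h0 | h0
    · rw [← sq_le_sq₀ (norm_nonneg _) (by positivity), mul_pow, Real.sq_sqrt h0]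
      exact hq x
    · have h13 : ‖R x‖ ^ 2 ≤ 0 :=
        (hq x).trans (mul_nonpos_of_nonpos_of_nonneg h0.le (sq_nonneg _))
      have h14 : ‖R x‖ = 0 := by nlinarith [norm_nonneg (R x)]
      rw [h14]; positivity
  have hlt : q2 < M ^ 2 := by
    have : 0 < 1 / (2 * M ^ 2 * C ^ 2) := by positivity
    linarith
  have := Real.sqrt_lt_sqrt_iff_of_pos (x := q2) (y := M ^ 2) (by positivity) |>.mpr hlt
  rw [Real.sqrt_sq hMpos.le] at this
  linarith

/-- Every approximate eigenvalue of a symmetric operator is close to its spectrum. -/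
theorem ContinuousLinearMap.exists_mem_spectrum_abs_sub_le (T : E →L[ℝ] E)
    (hT : (T : E →ₗ[ℝ] E).IsSymmetric) {l ε : ℝ} {f : E} (hf : f ≠ 0)
    (h : ‖T f - l • f‖ ≤ ε * ‖f‖) : ∃ s ∈ spectrum ℝ T, |s - l| ≤ ε := by
  have hfpos : 0 < ‖f‖ := norm_pos_iff.mpr hf
  have hε : 0 ≤ ε := nonneg_of_mul_nonneg_left ((norm_nonneg _).trans h) hfpos
  by_cases hl : l ∈ spectrum ℝ T
  · exact ⟨l, hl, by simpa using hε⟩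
  rw [spectrum.notMem_iff] at hl
  obtain ⟨u, hu⟩ := hl
  -- The resolvent `R = (l - T)⁻¹` is symmetric. The vector `f` shows `‖R‖ ≥ 1 / ε`, and a spectral
  -- point `±‖R‖` of `R` becomes the spectral point `l ∓ 1 / ‖R‖` of `T`.
  set R : E →L[ℝ] E := ↑u⁻¹ with hRdef
  have hRu : ∀ x, R ((u : E →L[ℝ] E) x) = x := fun x => by
    change ((↑u⁻¹ : E →L[ℝ] E) * (u : E →L[ℝ] E)) x = x
    simp
  have huR : ∀ x, (u : E →L[ℝ] E) (R x) = x := fun x => by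
    change ((u : E →L[ℝ] E) * (↑u⁻¹ : E →L[ℝ] E)) x = x
    simp
  have hux : ∀ x, (u : E →L[ℝ] E) x = l • x - T x := fun x => by
    rw [hu]
    simp [Algebra.algebraMap_eq_smul_one]
  have husymm : ∀ x y, inner ℝ ((u : E →L[ℝ] E) x) y = inner ℝ x ((u : E →L[ℝ] E) y) := by
    intro x y
    have h1 : inner ℝ (T x) y = inner ℝ x (T y) := hT x y
    rw [hux, hux, inner_sub_left, inner_sub_right, h1, inner_smul_left, inner_smul_right]
    rfl
  have hRsymm : (R : E →ₗ[ℝ] E).IsSymmetric := by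
    intro x y
    change inner ℝ (R x) y = inner ℝ x (R y)
    conv_lhs => rw [← huR y]
    rw [← husymm, huR]
  have hle : ‖f‖ ≤ ‖R‖ * (ε * ‖f‖) := by
    calc ‖f‖ = ‖R ((u : E →L[ℝ] E) f)‖ := by rw [hRu]
      _ ≤ ‖R‖ * ‖(u : E →L[ℝ] E) f‖ := R.le_opNorm _
      _ ≤ _ := by
        refine mul_le_mul_of_nonneg_left ?_ (norm_nonneg _)
        rw [hux, norm_sub_rev]
        exact h
  have hle' : 1 ≤ ‖R‖ * ε := by
    rw [← mul_assoc] at hle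
    exact le_of_mul_le_mul_right (by linarith) hfpos
  have hRpos : 0 < ‖R‖ := by
    rcases (norm_nonneg R).eq_or_lt with h0 | h0
    · rw [← h0, zero_mul] at hle'
      linarith
    · exact h0
  have hinv : ‖R‖⁻¹ ≤ ε := by
    rw [inv_le_iff_one_le_mul₀ hRpos, mul_comm]
    exact hle'
  -- Inversion carries the spectrum of `R` to that of `l - T`, and the reflection `x ↦ l - x`
  -- carries the latter to that of `T`.
  have hmain : ∀ m : ℝ, m ≠ 0 → m ∈ spectrum ℝ R → l - m⁻¹ ∈ spectrum ℝ T := by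
    intro m hm hmem
    have h2 : m⁻¹ ∈ spectrum ℝ (u : E →L[ℝ] E) := by
      have := (spectrum.inv_mem_iff (r := (Units.mk0 m hm)) (a := u⁻¹)).mp
        (by simpa using hmem)
      simpa using this
    intro hunit
    apply h2
    rw [spectrum.mem_resolventSet_iff] at hunit ⊢
    have : algebraMap ℝ (E →L[ℝ] E) m⁻¹ - (u : E →L[ℝ] E) =
        -(algebraMap ℝ (E →L[ℝ] E) (l - m⁻¹) - T) := by
      rw [hu, map_sub]; abel
    rw [this]
    exact hunit.neg
  rcases R.norm_mem_spectrum_or_neg_norm_mem_spectrum hRsymm (norm_pos_iff.mp hRpos) with h3 | h3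
  · refine ⟨_, hmain _ hRpos.ne' h3, ?_⟩
    rw [sub_sub_cancel_left, abs_neg, abs_of_pos (inv_pos.mpr hRpos)]
    exact hinv
  · refine ⟨_, hmain _ (neg_ne_zero.mpr hRpos.ne') h3, ?_⟩
    rw [sub_sub_cancel_left, inv_neg, neg_neg, abs_of_pos (inv_pos.mpr hRpos)]
    exact hinv

/-- Every point of the spectrum of a symmetric operator is an approximate eigenvalue. -/
theorem ContinuousLinearMap.exists_norm_sub_smul_lt [CompleteSpace E] (T : E →L[ℝ] E)
    (hT : (T : E →ₗ[ℝ] E).IsSymmetric) {l : ℝ} (hl : l ∈ spectrum ℝ T) {ε : ℝ} (hε : 0 < ε) :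
    ∃ f, ‖T f - l • f‖ < ε * ‖f‖ := by
  by_contra! h
  apply hl
  set S : E →L[ℝ] E := algebraMap ℝ (E →L[ℝ] E) l - T with hS
  have hSx : ∀ x, S x = l • x - T x := fun x => by
    simp [hS, Algebra.algebraMap_eq_smul_one]
  -- Without approximate eigenvectors `l - T` is bounded below, so it is injective with closed
  -- range; symmetry makes the orthogonal complement of the range its kernel, which is zero.
  have hlow : ∀ x, ε * ‖x‖ ≤ ‖S x‖ := fun x => by
    rw [hSx, norm_sub_rev]; exact h x
  have hanti : AntilipschitzWith (Real.toNNReal ε⁻¹) S := by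
    refine ContinuousLinearMap.antilipschitz_of_bound S fun x => ?_
    rw [Real.coe_toNNReal _ (by positivity), inv_mul_eq_div, le_div_iff₀ hε, mul_comm]
    exact hlow x
  have hclosed : IsClosed (Set.range S) := hanti.isClosed_range S.uniformContinuous
  have hrange : S.range = ⊤ := by
    have hcl : IsClosed ((S.range : Submodule ℝ E) : Set E) := by
      rw [LinearMap.coe_range]
      exact hclosed
    have : CompleteSpace (S.range : Submodule ℝ E) := hcl.completeSpace_coe
    rw [← Submodule.orthogonal_eq_bot_iff, Submodule.eq_bot_iff]
    intro y hy
    have h1 : ∀ x, inner ℝ (S x) y = 0 := fun x =>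
      (Submodule.mem_orthogonal _ _).mp hy _ ⟨x, rfl⟩
    -- Test the orthogonality of `y` against `S (S y)` and move one `S` to the other side.
    have h2 : inner ℝ (S y) (S y) = 0 := by
      have h3 := h1 (S y)
      have h4 : inner ℝ (T (S y)) y = inner ℝ (S y) (T y) := hT _ _
      rw [hSx (S y), inner_sub_left, h4, inner_smul_left] at h3
      nth_rewrite 2 [hSx y]
      rw [inner_sub_right, inner_smul_right]
      exact h3
    have h5 : S y = 0 := inner_self_eq_zero.mp h2
    have h6 := hlow y
    rw [h5, norm_zero] at h6
    have : ‖y‖ ≤ 0 := by nlinarith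
    exact norm_le_zero_iff.mp this
  rw [spectrum.mem_resolventSet_iff, ContinuousLinearMap.isUnit_iff_bijective]
  exact ⟨hanti.injective, LinearMap.range_eq_top.mp hrange⟩

end SymmetricOperators

namespace UniformComplex

noncomputable section

variable {V : Type*} {d : ℕ} (X : UniformComplex V d)

/-! ### The spaces of square summable forms -/

theorem weight_pos {n : ℕ} (a : X.OrientedCell n) : 0 < X.weight a.support := by
  obtain ⟨K, -, hK⟩ := X.weight_bounds
  exact (hK _ a.support_mem).1

theorem weight_le_one {n : ℕ} (a : X.OrientedCell n) : X.weight a.support ≤ 1 := by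
  obtain ⟨K, -, hK⟩ := X.weight_bounds
  exact (hK _ a.support_mem).2.1

theorem OmegaL2.ext {n : ℕ} {f g : X.OmegaL2 n} (h : ∀ a, f a = g a) : f = g :=
  Subtype.ext (funext h)

theorem OmegaL2.sub_apply {n : ℕ} (f g : X.OmegaL2 n) (a : X.OrientedCell n) :
    (f - g) a = f a - g a := rfl

theorem OmegaL2.smul_apply {n : ℕ} (c : ℝ) (f : X.OmegaL2 n) (a : X.OrientedCell n) :
    (c • f) a = c * f a := rfl

theorem OmegaL2.inner_eq {n : ℕ} (f g : X.OmegaL2 n) :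
    inner ℝ f g = (1 / 2) * ∑' a : X.OrientedCell n, X.weight a.support * (f a * g a) := rfl

/-- The half under the root compensates for every cell being counted with both orientations, so that
the rescaling is isometric. -/
theorem OmegaL2.memℓp {n : ℕ} (f : X.OmegaL2 n) :
    Memℓp (fun a : X.OrientedCell n => Real.sqrt (X.weight a.support / 2) * f a) 2 := by
  refine (memℓp_gen_iff (by norm_num)).mpr ?_
  refine (f.2.2.mul_left (1 / 2)).congr fun a => ?_
  simp only [ENNReal.toReal_ofNat, Real.norm_eq_abs]
  rw [Real.rpow_ofNat, sq_abs, mul_pow,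
    Real.sq_sqrt (div_nonneg (X.weight_pos a).le (by norm_num))]
  ring

/-- The isometric embedding of the square summable forms into `ℓ²`. -/
def toLp (n : ℕ) : X.OmegaL2 n →ₗᵢ[ℝ] lp (fun _ : X.OrientedCell n => ℝ) 2 where
  toFun f := ⟨fun a => Real.sqrt (X.weight a.support / 2) * f a, OmegaL2.memℓp X f⟩
  map_add' f g := Subtype.ext (funext fun a => mul_add _ _ _)
  map_smul' c f := Subtype.ext (funext fun a => mul_left_comm _ _ _)
  norm_map' f := by
    rw [← sq_eq_sq₀ (norm_nonneg _) (norm_nonneg _), OmegaL2.norm_sq]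
    have h := lp.norm_rpow_eq_tsum (p := 2) (by norm_num)
      (⟨fun a => Real.sqrt (X.weight a.support / 2) * f a, OmegaL2.memℓp X f⟩ :
        lp (fun _ : X.OrientedCell n => ℝ) 2)
    simp only [ENNReal.toReal_ofNat, Real.norm_eq_abs, Real.rpow_ofNat] at h
    refine h.trans ?_
    rw [← tsum_mul_left]
    refine tsum_congr fun a => ?_
    rw [sq_abs, mul_pow, Real.sq_sqrt (div_nonneg (X.weight_pos a).le (by norm_num))]
    ring

theorem toLp_apply {n : ℕ} (f : X.OmegaL2 n) (a : X.OrientedCell n) :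
    X.toLp n f a = Real.sqrt (X.weight a.support / 2) * f a := rfl

/-- The rescaling factor is positive and depends only on the unoriented cell, so dividing by it
preserves antisymmetry and inverts the embedding. -/
theorem range_toLp (n : ℕ) : Set.range (X.toLp n) = {g | ∀ a, g a.flip = -g a} := by
  ext g
  constructor
  · rintro ⟨f, rfl⟩ a
    rw [toLp_apply, toLp_apply, OrientedCell.support_flip, f.2.1 a, mul_neg]
  · intro hg
    have hpos : ∀ a : X.OrientedCell n, 0 < Real.sqrt (X.weight a.support / 2) := fun a =>
      Real.sqrt_pos.mpr (half_pos (X.weight_pos a))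
    refine ⟨⟨fun a => g a / Real.sqrt (X.weight a.support / 2), fun a => ?_, ?_⟩, ?_⟩
    · change g a.flip / Real.sqrt (X.weight a.flip.support / 2) = _
      rw [a.support_flip, hg a]
      exact neg_div _ _
    · have h := (memℓp_gen_iff (p := 2) (by norm_num)).mp (lp.memℓp g)
      refine (h.mul_left 2).congr fun a => ?_
      simp only [ENNReal.toReal_ofNat, Real.norm_eq_abs]
      rw [Real.rpow_ofNat, sq_abs, div_pow,
        Real.sq_sqrt (div_nonneg (X.weight_pos a).le (by norm_num))]
      have := (X.weight_pos a).ne'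
      field_simp
    · ext a
      exact mul_div_cancel₀ _ (hpos a).ne'

/-- Antisymmetry is an intersection of closed conditions on coordinates, so the isometric image is
closed in `ℓ²`. -/
instance (n : ℕ) : CompleteSpace (X.OmegaL2 n) := by
  rw [completeSpace_iff_isComplete_range (X.toLp n).isometry.isUniformInducing, range_toLp]
  refine IsClosed.isComplete ?_
  have hc : ∀ a : X.OrientedCell n,
      Continuous fun g : lp (fun _ : X.OrientedCell n => ℝ) 2 => g a := fun a =>
    (continuous_apply a).comp lp.uniformContinuous_coe.continuous
  rw [Set.ofPred_forall]
  exact isClosed_iInter fun a => isClosed_eq (hc _) (hc _).neg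

/-- Only the identity permutation fixes an ordering of distinct vertices, and its sign is not `-1`.
-/
theorem OrientedCell.flip_ne_self {n : ℕ} (a : X.OrientedCell n) : a.flip ≠ a := by
  induction a using Quotient.inductionOn with
  | h a =>
  obtain ⟨t, s⟩ := a
  intro h
  obtain ⟨π, h1, h2⟩ := Quotient.exact (s := X.orientedSetoid n) (a := (t, -s)) (b := (t, s)) h
  have hπ : π = 1 := by
    ext i
    have h3 := congrArg (fun e : Fin n ↪ V => e i) h1
    have h4 : i = π i := t.1.injective h3
    rw [← h4]
    rfl
  rw [hπ, Equiv.Perm.sign_one, one_mul] at h2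
  exact units_ne_neg_self s h2.symm.symm

-- The antisymmetrized indicator of one oriented cell is a nonzero form. It is needed to make every
-- spectrum nonempty, also for those `n` whose balls do not match yet.
open Classical in
theorem nontrivial_omegaL2 {n : ℕ} (a : X.OrientedCell n) : Nontrivial (X.OmegaL2 n) := by
  let f : X.OrientedCell n → ℝ := fun b => if b = a then 1 else if b = a.flip then -1 else 0
  have hf : ∀ b, f b.flip = -f b := by
    intro b
    have h1 : (b.flip = a) = (b = a.flip) :=
      propext ⟨fun h => by rw [← h, b.flip_flip], fun h => by rw [h, a.flip_flip]⟩
    have h2 : (b.flip = a.flip) = (b = a) :=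
      propext ⟨fun h => by rw [← b.flip_flip, h, a.flip_flip], fun h => by rw [h]⟩
    simp only [f, h1, h2]
    by_cases h3 : b = a
    · rw [h3, if_neg (OrientedCell.flip_ne_self X a).symm, if_pos rfl, if_pos rfl]
    · by_cases h4 : b = a.flip
      · rw [if_pos h4, if_neg h3, if_pos h4, neg_neg]
      · rw [if_neg h4, if_neg h3, if_neg h3, if_neg h4, neg_zero]
  have hs : Summable fun b => X.weight b.support * f b ^ 2 := by
    refine summable_of_ne_finset_zero (s := {a, a.flip}) fun b hb => ?_
    simp only [Finset.mem_insert, Finset.mem_singleton, not_or] at hb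
    simp only [f, if_neg hb.1, if_neg hb.2]
    ring
  refine ⟨⟨⟨f, hf, hs⟩, 0, fun h => ?_⟩⟩
  have h1 : f a = 0 := congrArg (fun g : X.OmegaL2 n => g a) h
  simp [f] at h1

theorem exists_orientedCell {n : ℕ} {s : Finset V} (hs : s ∈ X.faces) (hn : s.card = n) :
    ∃ a : X.OrientedCell n, a.support = s := by
  subst hn
  have h : Finset.univ.map (s.equivFin.symm.toEmbedding.trans (Function.Embedding.subtype _)) = s := by
    ext v
    simp only [Finset.mem_map, Finset.mem_univ, true_and]
    constructor
    · rintro ⟨i, rfl⟩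
      exact (s.equivFin.symm i).2
    · intro hv
      exact ⟨s.equivFin ⟨v, hv⟩, by simp⟩
  exact ⟨OrientedCell.mk ⟨_, h.symm ▸ hs⟩ 1, h⟩

/-! ### Adjoints of the kernel operators -/

-- Each value `h a` occurs at most `N` times in the double family. This supplies the dominating
-- series for exchanging the sums in the adjointness formula.
open Classical in
theorem summable_of_finite_columns {α β : Type*} (R : α → β → Prop) (N : ℕ)
    (hN : ∀ a, ∃ S : Finset β, S.card ≤ N ∧ ∀ b, R a b → b ∈ S) (h : α → ℝ) (h0 : ∀ a, 0 ≤ h a)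
    (hs : Summable h) : Summable fun p : α × β => if R p.1 p.2 then h p.1 else 0 := by
  have hcol : ∀ a, ∃ S : Finset β, S.card ≤ N ∧
      ∀ b, b ∉ S → (if R a b then h a else 0) = 0 := fun a => by
    obtain ⟨S, hS, hSR⟩ := hN a
    exact ⟨S, hS, fun b hb => if_neg fun hr => hb (hSR b hr)⟩
  have hnn : ∀ a b, 0 ≤ if R a b then h a else 0 := fun a b => by
    split_ifs
    · exact h0 a
    · exact le_rfl
  rw [summable_prod_of_nonneg fun p => hnn p.1 p.2]
  refine ⟨fun a => ?_, Summable.of_nonneg_of_le (fun a => tsum_nonneg (hnn a)) (fun a => ?_)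
    (hs.mul_left (N : ℝ))⟩
  · obtain ⟨S, -, hS⟩ := hcol a
    exact summable_of_ne_finset_zero (s := S) hS
  · obtain ⟨S, hc, hS⟩ := hcol a
    change ∑' b, (if R a b then h a else 0) ≤ _
    rw [tsum_eq_sum (s := S) hS]
    refine (Finset.sum_le_card_nsmul _ _ (h a) fun b _ => ?_).trans ?_
    · split_ifs
      · exact le_rfl
      · exact h0 a
    · rw [nsmul_eq_mul]
      exact mul_le_mul_of_nonneg_right (by exact_mod_cast hc) (h0 a)

open Classical in
/-- The kernel operators of a relation and of its transpose, both with the weights of the source as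
coefficients, are adjoint to each other. -/
theorem inner_kernelOperator {m n : ℕ} (hm : d ≤ m) (hn : d ≤ n)
    (R : X.OrientedCell m → X.OrientedCell n → Prop)
    (R' : X.OrientedCell n → X.OrientedCell m → Prop) (hRR' : ∀ a b, R' b a ↔ R a b)
    (c c' : Finset V → ℝ) (hR : ∀ a b, R a b → R a.flip b.flip) (hclose : ∀ a b, R a b → Close a b)
    (hc : ∀ σ ∈ X.faces, |c σ| ≤ 1)
    (hR' : ∀ a b, R' a b → R' a.flip b.flip) (hclose' : ∀ a b, R' a b → Close a b)
    (hc' : ∀ σ ∈ X.faces, |c' σ| ≤ 1)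
    (hcw : ∀ a : X.OrientedCell m, c a.support = X.weight a.support)
    (hcw' : ∀ b : X.OrientedCell n, c' b.support = X.weight b.support)
    (f : X.OmegaL2 m) (g : X.OmegaL2 n) :
    inner ℝ (X.kernelOperator hm hn R c hR hclose hc f) g =
      inner ℝ f (X.kernelOperator hn hm R' c' hR' hclose' hc' g) := by
  obtain ⟨M, hM⟩ := X.exists_close_bound m n hn
  obtain ⟨N, hN⟩ := X.exists_close_bound n m hm
  have hcol : ∀ a, ∃ S : Finset (X.OrientedCell n), S.card ≤ N ∧ ∀ b, R a b → b ∈ S := fun a => by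
    obtain ⟨S, hS, h⟩ := hN a
    exact ⟨S, hS, fun b hb => h b (hclose a b hb).symm⟩
  have hrow : ∀ b, ∃ S : Finset (X.OrientedCell m), S.card ≤ M ∧ ∀ a, R a b → a ∈ S := fun b => by
    obtain ⟨S, hS, h⟩ := hM b
    exact ⟨S, hS, fun a ha => h a (hclose a b ha)⟩
  have hs1 := summable_of_finite_columns R N hcol (fun a => X.weight a.support * f a ^ 2)
    (fun a => mul_nonneg (X.weight_pos a).le (sq_nonneg _)) f.2.2
  have hs2 := (summable_of_finite_columns (fun b a => R a b) M hrow
    (fun b => X.weight b.support * g b ^ 2)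
    (fun b => mul_nonneg (X.weight_pos b).le (sq_nonneg _)) g.2.2).prod_symm
  -- Since the coefficients are the weights, both inner products are iterated sums of this one
  -- kernel, in opposite orders.
  let F : X.OrientedCell m → X.OrientedCell n → ℝ := fun a b =>
    if R a b then X.weight a.support * X.weight b.support * (f a * g b) else 0
  have hF : Summable (Function.uncurry F) := by
    -- Absolute convergence uses `|f a * g b| ≤ f a ^ 2 + g b ^ 2` and that the weights are at most
    -- one.
    refine Summable.of_norm_bounded (hs1.add hs2) ?_
    rintro ⟨a, b⟩
    simp only [Function.uncurry, F, Prod.swap]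
    split_ifs
    · have ha0 := (X.weight_pos a).le
      have hb0 := (X.weight_pos b).le
      have ha1 := X.weight_le_one a
      have hb1 := X.weight_le_one b
      rw [Real.norm_eq_abs, abs_mul, abs_of_nonneg (mul_nonneg ha0 hb0)]
      have h1 : |f a * g b| ≤ f a ^ 2 + g b ^ 2 := by
        rw [abs_le]
        constructor <;> nlinarith [sq_nonneg (f.1 a - g.1 b), sq_nonneg (f.1 a + g.1 b)]
      calc X.weight a.support * X.weight b.support * |f a * g b|
          ≤ X.weight a.support * X.weight b.support * (f a ^ 2 + g b ^ 2) :=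
            mul_le_mul_of_nonneg_left h1 (mul_nonneg ha0 hb0)
        _ = X.weight a.support * f a ^ 2 * X.weight b.support +
            X.weight b.support * g b ^ 2 * X.weight a.support := by ring
        _ ≤ _ := add_le_add (mul_le_of_le_one_right (mul_nonneg ha0 (sq_nonneg _)) hb1)
            (mul_le_of_le_one_right (mul_nonneg hb0 (sq_nonneg _)) ha1)
    · simp
  rw [OmegaL2.inner_eq, OmegaL2.inner_eq]
  congr 1
  have e1 : ∀ b, X.weight b.support * (X.kernelOperator hm hn R c hR hclose hc f b * g b) =
      ∑' a, F a b := fun b => by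
    obtain ⟨S, -, hS⟩ := hrow b
    rw [kernelOperator_apply, finsum_mem_def, tsum_eq_finsum, finsum_mul, mul_finsum]
    · refine finsum_congr fun a => ?_
      by_cases h : R a b
      · rw [Set.indicator_of_mem (by exact h), hcw]
        simp only [F, if_pos h]
        ring
      · rw [Set.indicator_of_notMem (by exact h)]
        simp only [F, if_neg h]
        ring
    · refine S.finite_toSet.subset fun a ha => ?_
      by_contra h
      exact ha (if_neg fun hr => h (hS a hr))
  have e2 : ∀ a, X.weight a.support * (f a * X.kernelOperator hn hm R' c' hR' hclose' hc' g a) =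
      ∑' b, F a b := fun a => by
    obtain ⟨S, -, hS⟩ := hcol a
    rw [kernelOperator_apply, finsum_mem_def, tsum_eq_finsum, mul_finsum, mul_finsum]
    · refine finsum_congr fun b => ?_
      by_cases h : R a b
      · rw [Set.indicator_of_mem (by exact (hRR' a b).mpr h), hcw']
        simp only [F, if_pos h]
        ring
      · rw [Set.indicator_of_notMem (by exact fun hr => h ((hRR' a b).mp hr))]
        simp only [F, if_neg h]
        ring
    · refine S.finite_toSet.subset fun b hb => ?_
      by_contra h
      exact hb (if_neg fun hr => h (hS b hr))
  rw [tsum_congr e1, tsum_congr e2]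
  exact hF.tsum_comm

/-- Here the coefficients `1 / deg` of the walk and of the coboundary are recognized as weights, the
condition for adjointness; on `d`-cells the weight is the boundary coefficient `1`. -/
theorem weight_orientedCell (a : X.OrientedCell d) :
    X.weight a.support = 1 / (X.deg a.support : ℝ) := if_pos a.card_support

theorem weight_orientedCell_succ (a : X.OrientedCell (d + 1)) : X.weight a.support = 1 :=
  if_neg (by rw [a.card_support]; omega)

theorem Neighbor.symm {n : ℕ} {a b : X.OrientedCell n} (h : Neighbor a b) : Neighbor b a := by
  obtain ⟨hne, τ, h1, h2⟩ := h
  refine ⟨fun e => hne (by rw [← e, a.flip_flip]), τ.flip, ?_, h1.flip⟩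
  have := h2.flip
  rwa [b.flip_flip] at this

theorem isSymmetric_neighborSum :
    (X.neighborSum : X.OmegaL2 d →ₗ[ℝ] X.OmegaL2 d).IsSymmetric := fun f g =>
  X.inner_kernelOperator _ _ _ _ (fun _ _ => ⟨Neighbor.symm X, Neighbor.symm X⟩) _ _ _ _ _ _ _ _
    (fun a => (X.weight_orientedCell a).symm) (fun a => (X.weight_orientedCell a).symm) f g

theorem inner_coboundary (f : X.OmegaL2 d) (g : X.OmegaL2 (d + 1)) :
    inner ℝ (X.coboundary f) g = inner ℝ f (X.boundary g) :=
  X.inner_kernelOperator _ _ _ _ (fun _ _ => Iff.rfl) _ _ _ _ _ _ _ _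
    (fun a => (X.weight_orientedCell a).symm) (fun a => (X.weight_orientedCell_succ a).symm) f g

theorem isSymmetric_upperLaplacian :
    (X.upperLaplacian : X.OmegaL2 d →ₗ[ℝ] X.OmegaL2 d).IsSymmetric := fun f g => by
  change inner ℝ (X.boundary (X.coboundary f)) g = inner ℝ f (X.boundary (X.coboundary g))
  rw [real_inner_comm, ← inner_coboundary, real_inner_comm, inner_coboundary]

theorem transitionOperator_zero_apply (f : X.OmegaL2 d) :
    X.transitionOperator 0 f = (1 / (d : ℝ)) • X.neighborSum f := by
  simp [transitionOperator]

theorem isSymmetric_transitionOperator :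
    (X.transitionOperator 0 : X.OmegaL2 d →ₗ[ℝ] X.OmegaL2 d).IsSymmetric := fun f g => by
  change inner ℝ (X.transitionOperator 0 f) g = inner ℝ f (X.transitionOperator 0 g)
  rw [transitionOperator_zero_apply, transitionOperator_zero_apply, inner_smul_left,
    inner_smul_right]
  exact congrArg _ (X.isSymmetric_neighborSum f g)

end

end UniformComplex

namespace UniformComplex

noncomputable section

variable {V : Type*} {d : ℕ} (X : UniformComplex V d)

/-! ### Balls -/

section Balls

variable {X}

theorem mem_faces_of_subset {s t : Finset V} (ht : t ∈ X.faces) (hst : s ⊆ t) (hs : s.Nonempty) :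
    s ∈ X.faces := X.isRelLowerSet_faces.mem_of_le ht hst hs

theorem nonempty_of_mem_faces {s : Finset V} (hs : s ∈ X.faces) : s.Nonempty :=
  (X.isRelLowerSet_faces hs).1

theorem ball_subset_faces {σ : X.Cell} {r : ℕ} {s : Finset V} (hs : s ∈ X.ball σ r) :
    s ∈ X.faces := by
  obtain ⟨hne, τ, hτ, hsub, -⟩ := hs
  exact mem_faces_of_subset hτ hsub hne

theorem ball_mono {σ : X.Cell} {r k : ℕ} (hrk : r ≤ k) : X.ball σ r ⊆ X.ball σ k := by
  rintro s ⟨hne, τ, hτ, hsub, hc, h⟩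
  exact ⟨hne, τ, hτ, hsub, hc, fun c hcτ => (h c hcτ).trans (by exact_mod_cast hrk)⟩

theorem ball_of_subset {σ : X.Cell} {r : ℕ} {s t : Finset V} (ht : t ∈ X.ball σ r) (hst : s ⊆ t)
    (hs : s.Nonempty) : s ∈ X.ball σ r := by
  obtain ⟨-, τ, hτ, hsub, h⟩ := ht
  exact ⟨hs, τ, hτ, hst.trans hsub, h⟩

theorem ball_singleton {σ : X.Cell} {r : ℕ} {t : Finset V} (ht : t ∈ X.ball σ r) {v : V}
    (hv : v ∈ t) : {v} ∈ X.ball σ r :=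
  ball_of_subset ht (Finset.singleton_subset_iff.mpr hv) (Finset.singleton_nonempty v)

/-- A `(d-1)`-cell is its own only `(d-1)`-face, so it can serve as the enclosing cell in the
definition of the ball. -/
theorem cell_mem_ball_iff {σ c : X.Cell} {r : ℕ} :
    c.1 ∈ X.ball σ r ↔ X.cellGraph.edist σ c ≤ r := by
  constructor
  · rintro ⟨-, τ, -, hsub, -, h⟩
    exact h c hsub
  · intro h
    refine ⟨nonempty_of_mem_faces c.2.1, c.1, c.2.1, subset_rfl, c.2.2.ge, fun c' hc' => ?_⟩
    have : c' = c := Subtype.ext (Finset.eq_of_subset_of_card_le hc' (by rw [c.2.2, c'.2.2]))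
    rwa [this]

theorem center_mem_ball (σ : X.Cell) (r : ℕ) : σ.1 ∈ X.ball σ r :=
  cell_mem_ball_iff.mpr (by simp)

-- Two distinct `d`-element subsets of a set with `d + 1` elements have the whole set as their
-- union.
open Classical in
theorem edist_le_one {c c' : X.Cell} {t : Finset V} (ht : t ∈ X.faces) (htc : t.card = d + 1)
    (hc : c.1 ⊆ t) (hc' : c'.1 ⊆ t) : X.cellGraph.edist c c' ≤ 1 := by
  rw [SimpleGraph.edist_le_one_iff_adj_or_eq]
  by_cases h : c = c'
  · exact Or.inr h
  · left
    have hlt : d < (c.1 ∪ c'.1).card := by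
      by_contra hle
      have h1 : c.1 = c.1 ∪ c'.1 :=
        Finset.eq_of_subset_of_card_le Finset.subset_union_left (by rw [c.2.2]; omega)
      have h2 : c'.1 = c.1 ∪ c'.1 :=
        Finset.eq_of_subset_of_card_le Finset.subset_union_right (by rw [c'.2.2]; omega)
      exact h (Subtype.ext (h1.trans h2.symm))
    have heq : c.1 ∪ c'.1 = t :=
      Finset.eq_of_subset_of_card_le (Finset.union_subset hc hc') (by rw [htc]; omega)
    change c.1 ∪ c'.1 ∈ X.faces ∧ (c.1 ∪ c'.1).card = d + 1
    rw [heq]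
    exact ⟨ht, htc⟩

/-- A `d`-cell that meets a ball in a cell of dimension at least `d - 1` lies in the ball of radius
one more. -/
theorem mem_ball_succ (hd : 1 ≤ d) {σ : X.Cell} {r : ℕ} {s t : Finset V} (hs : s ∈ X.ball σ r)
    (hsc : d ≤ s.card) (ht : t ∈ X.faces) (htc : t.card = d + 1) (hst : s ⊆ t) :
    t ∈ X.ball σ (r + 1) := by
  obtain ⟨c, hcs, hcc⟩ := Finset.exists_subset_card_eq hsc
  have hcb := ball_of_subset hs hcs (Finset.card_pos.mp (by omega))
  let c₀ : X.Cell := ⟨c, ball_subset_faces hcb, hcc⟩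
  refine ⟨nonempty_of_mem_faces ht, t, ht, subset_rfl, by omega, fun c' hc' => ?_⟩
  have h1 : X.cellGraph.edist σ c₀ ≤ r := cell_mem_ball_iff.mp hcb
  have h2 : X.cellGraph.edist c₀ c' ≤ 1 := edist_le_one ht htc (hcs.trans hst) hc'
  calc X.cellGraph.edist σ c' ≤ X.cellGraph.edist σ c₀ + X.cellGraph.edist c₀ c' :=
        SimpleGraph.edist_triangle
    _ ≤ r + 1 := add_le_add h1 h2
    _ = _ := by push_cast; rfl

/-- This is the locality of all the operators: one application reaches at most one radius further.
-/
theorem Close.mem_ball (hd : 1 ≤ d) {m n : ℕ} (hm : d ≤ m) {a : X.OrientedCell m}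
    {b : X.OrientedCell n} (h : Close a b) {σ : X.Cell} {r : ℕ} (ha : a.support ∈ X.ball σ r) :
    b.support ∈ X.ball σ (r + 1) := by
  obtain ⟨t, ht, htc, hat, hbt⟩ := h
  exact ball_of_subset (mem_ball_succ hd ha (by rw [a.card_support]; exact hm) ht htc hat) hbt
    (nonempty_of_mem_faces b.support_mem)

open Classical in
theorem exists_adj_of_edist_le {σ c : X.Cell} {k : ℕ}
    (h : X.cellGraph.edist σ c ≤ (k + 1 : ℕ)) : X.cellGraph.edist σ c ≤ k ∨
      ∃ c', X.cellGraph.edist σ c' ≤ k ∧ c'.1 ∪ c.1 ∈ X.faces ∧ (c'.1 ∪ c.1).card = d + 1 := by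
  -- The walk is reversed so that its first edge is the one at `c`.
  rw [SimpleGraph.edist_comm] at h
  obtain ⟨p, hp⟩ := SimpleGraph.exists_walk_of_edist_ne_top
    (ne_top_of_le_ne_top (ENat.natCast_ne_top _) h)
  rw [← hp] at h
  have h' : p.length ≤ k + 1 := by exact_mod_cast h
  cases p with
  | nil => left; simp
  | cons hadj q =>
    right
    refine ⟨_, ?_, hadj.symm⟩
    rw [SimpleGraph.edist_comm]
    refine (SimpleGraph.edist_le q).trans ?_
    rw [SimpleGraph.Walk.length_cons] at h'
    exact_mod_cast Nat.le_of_succ_le_succ h'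

/-- Connectedness enters here: finite distances to `σ` make the balls exhaust the complex. -/
theorem exists_mem_ball (hd : 1 ≤ d) (hX : X.IsConnected) (σ : X.Cell) {s : Finset V}
    (hs : s ∈ X.faces) : ∃ r, s ∈ X.ball σ r := by
  obtain ⟨t, ht, hst, htc⟩ := X.uniform s hs
  obtain ⟨c, hct, hcc⟩ := Finset.exists_subset_card_eq (s := t) (n := d) (by omega)
  have hc := mem_faces_of_subset ht hct (Finset.card_pos.mp (by omega))
  let c₀ : X.Cell := ⟨c, hc, hcc⟩
  have hne : X.cellGraph.edist σ c₀ ≠ ⊤ := SimpleGraph.edist_ne_top_iff_reachable.mpr (hX.preconnected σ c₀)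
  obtain ⟨r, hr⟩ := ENat.ne_top_iff_exists.mp hne
  have hcb : c₀.1 ∈ X.ball σ r := cell_mem_ball_iff.mpr hr.ge
  exact ⟨r + 1, ball_of_subset (mem_ball_succ hd hcb hcc.ge ht htc hct) hst
    (nonempty_of_mem_faces hs)⟩

end Balls

/-! ### Isomorphisms of balls -/

variable {X}
variable {W : Type*} {Y : UniformComplex W d}

open Classical in
/-- An isomorphism between two balls, given by two functions on all vertices that are inverse to
each other on the vertices of the balls. -/
structure BallEquiv (X : UniformComplex V d) (σ : X.Cell) (Y : UniformComplex W d) (τ : Y.Cell)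
    (R : ℕ) where
  toFun : V → W
  invFun : W → V
  map_mem : ∀ s ∈ X.ball σ R, s.image toFun ∈ Y.ball τ R
  inv_mem : ∀ s ∈ Y.ball τ R, s.image invFun ∈ X.ball σ R
  left_inv : ∀ v, {v} ∈ X.ball σ R → invFun (toFun v) = v
  right_inv : ∀ v, {v} ∈ Y.ball τ R → toFun (invFun v) = v
  map_center : σ.1.image toFun = τ.1
  inv_center : τ.1.image invFun = σ.1

namespace BallEquiv

variable {σ : X.Cell} {τ : Y.Cell} {R : ℕ} (e : BallEquiv X σ Y τ R)

/-- The inverse isomorphism. -/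
def symm : BallEquiv Y τ X σ R where
  toFun := e.invFun
  invFun := e.toFun
  map_mem := e.inv_mem
  inv_mem := e.map_mem
  left_inv := e.right_inv
  right_inv := e.left_inv
  map_center := e.inv_center
  inv_center := e.map_center

theorem injOn {s : Finset V} (hs : s ∈ X.ball σ R) : Set.InjOn e.toFun s := by
  intro v hv w hw h
  rw [← e.left_inv v (ball_singleton hs hv), h, e.left_inv w (ball_singleton hs hw)]

open Classical in
theorem card_image {s : Finset V} (hs : s ∈ X.ball σ R) : (s.image e.toFun).card = s.card :=
  Finset.card_image_of_injOn (e.injOn hs)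

open Classical in
theorem image_image {s : Finset V} (hs : s ∈ X.ball σ R) :
    (s.image e.toFun).image e.invFun = s := by
  rw [Finset.image_image]
  conv_rhs => rw [← Finset.image_id (s := s)]
  exact Finset.image_congr fun v hv => e.left_inv v (ball_singleton hs hv)

-- Distances refer to the whole complex, so chains have to be carried over. A chain of length at
-- most `k ≤ R` from the center uses only `d-cells` inside the ball, and their images are again
-- cells; induction follows the chain.
open Classical in
theorem cell_image_mem_ball (hd : 1 ≤ d) {k : ℕ} (hk : k ≤ R) (c : X.Cell)
    (hc : X.cellGraph.edist σ c ≤ k) : c.1.image e.toFun ∈ Y.ball τ k := by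
  induction k generalizing c with
  | zero =>
    have : σ = c := by simpa using hc
    rw [← this, e.map_center]
    exact center_mem_ball _ _
  | succ k ih =>
    rcases exists_adj_of_edist_le hc with h | ⟨c', hc', ht, htc⟩
    · exact ball_mono (Nat.le_succ k) (ih (by omega) c h)
    · have hb' : c'.1 ∈ X.ball σ k := cell_mem_ball_iff.mpr hc'
      have htb : c'.1 ∪ c.1 ∈ X.ball σ R := ball_mono hk
        (mem_ball_succ hd hb' c'.2.2.ge ht htc Finset.subset_union_left)
      have h1 : (c'.1 ∪ c.1).image e.toFun ∈ Y.ball τ (k + 1) := by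
        refine mem_ball_succ hd (ih (by omega) c' hc') ?_ (ball_subset_faces (e.map_mem _ htb)) ?_
          (Finset.image_subset_image Finset.subset_union_left)
        · rw [e.card_image (ball_mono (by omega) hb'), c'.2.2]
        · rw [e.card_image htb, htc]
      exact ball_of_subset h1 (Finset.image_subset_image Finset.subset_union_right)
        ((nonempty_of_mem_faces c.2.1).image _)

open Classical in
/-- An isomorphism of balls maps the smaller concentric balls to each other. -/
theorem image_mem_ball (hd : 1 ≤ d) {k : ℕ} (hk : k ≤ R) {s : Finset V} (hs : s ∈ X.ball σ k) :
    s.image e.toFun ∈ Y.ball τ k := by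
  obtain ⟨hne, t, ht, hst, htc, h⟩ := hs
  have htb : t ∈ X.ball σ R :=
    ball_mono hk ⟨nonempty_of_mem_faces ht, t, ht, subset_rfl, htc, h⟩
  refine ⟨hne.image _, t.image e.toFun, ball_subset_faces (e.map_mem t htb),
    Finset.image_subset_image hst, by rwa [e.card_image htb], fun c hc => ?_⟩
  have hcb : c.1 ∈ Y.ball τ R :=
    ball_of_subset (e.map_mem t htb) hc (nonempty_of_mem_faces c.2.1)
  -- Every `(d-1)`-face of the image comes from a face of `t`, whose distance from the center is
  -- already controlled.
  have hsub : c.1.image e.invFun ⊆ t := by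
    have := Finset.image_subset_image (f := e.invFun) hc
    rwa [e.image_image htb] at this
  let c' : X.Cell := ⟨c.1.image e.invFun, ball_subset_faces (e.inv_mem _ hcb),
    (e.symm.card_image hcb).trans c.2.2⟩
  have h1 := e.cell_image_mem_ball hd hk c' (h c' hsub)
  have h2 : c'.1.image e.toFun = c.1 := e.symm.image_image hcb
  rw [h2] at h1
  exact cell_mem_ball_iff.mp h1

-- The margin `k + 1 ≤ R` puts all cofaces of `s` inside the ball, where the isomorphism maps them
-- injectively to cofaces of the image. Applied to the inverse as well, this gives equality of
-- degrees.
open Classical in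
theorem deg_le_deg_image (hd : 1 ≤ d) {k : ℕ} (hk : k + 1 ≤ R) {s : Finset V}
    (hs : s ∈ X.ball σ k) (hsc : s.card = d) : X.deg s ≤ Y.deg (s.image e.toFun) := by
  have hsR := ball_mono (show k ≤ R by omega) hs
  have hball : ∀ t ∈ X.cofaces s, t ∈ X.ball σ R := fun t ht =>
    ball_mono hk (mem_ball_succ hd hs hsc.ge ht.1 (by rw [ht.2.2, hsc]) ht.2.1)
  have hfin : (Y.cofaces (s.image e.toFun)).Finite := by
    obtain ⟨K, hK⟩ := Y.bounded_degree
    exact Set.finite_of_encard_le_coe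
      (hK _ (ball_subset_faces (e.map_mem s hsR)) (by rw [e.card_image hsR, hsc]))
  refine Set.ncard_le_ncard_of_injOn (fun t => t.image e.toFun) (fun t ht => ?_) ?_ hfin
  · have htb := hball t ht
    exact ⟨ball_subset_faces (e.map_mem t htb), Finset.image_subset_image ht.2.1,
      by rw [e.card_image htb, e.card_image hsR, ht.2.2]⟩
  · intro t ht t' ht' h
    rw [← e.image_image (hball t ht), ← e.image_image (hball t' ht')]
    exact congrArg _ h

open Classical in
theorem deg_image (hd : 1 ≤ d) {k : ℕ} (hk : k + 1 ≤ R) {s : Finset V}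
    (hs : s ∈ X.ball σ k) (hsc : s.card = d) : Y.deg (s.image e.toFun) = X.deg s := by
  have hsR := ball_mono (show k ≤ R by omega) hs
  refine le_antisymm ?_ (e.deg_le_deg_image hd hk hs hsc)
  have h := e.symm.deg_le_deg_image hd hk (e.image_mem_ball hd (by omega) hs)
    (by rw [e.card_image hsR, hsc])
  change _ ≤ X.deg (Finset.image e.invFun _) at h
  rwa [e.image_image hsR] at h

open Classical in
theorem weight_image (hd : 1 ≤ d) {k : ℕ} (hk : k + 1 ≤ R) {s : Finset V}
    (hs : s ∈ X.ball σ k) : Y.weight (s.image e.toFun) = X.weight s := by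
  have hsR := ball_mono (show k ≤ R by omega) hs
  unfold weight
  rw [e.card_image hsR]
  split_ifs with h
  · rw [e.deg_image hd hk hs h]
  · rfl

/-! ### Transport of oriented cells -/

open Classical in
/-- The image of an ordered cell. -/
def mapOrdered {n : ℕ} (t : X.OrderedCell n) (h : Finset.univ.map t.1 ∈ X.ball σ R) :
    Y.OrderedCell n :=
  ⟨⟨fun i => e.toFun (t.1 i), fun i j hij =>
    t.1.injective (e.injOn h (by simp) (by simp) hij)⟩, by
      have h1 := ball_subset_faces (e.map_mem _ h)
      rw [Finset.map_eq_image, Finset.image_image] at h1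
      rw [Finset.map_eq_image]
      exact h1⟩

theorem support_out {n : ℕ} (a : X.OrientedCell n) :
    Finset.univ.map (Quotient.out a).1.1 = a.support := by
  conv_rhs => rw [← Quotient.out_eq a]
  rfl

/-- The image of an oriented cell of the ball. -/
def push {n : ℕ} (a : X.OrientedCell n) (h : a.support ∈ X.ball σ R) : Y.OrientedCell n :=
  OrientedCell.mk (e.mapOrdered (Quotient.out a).1 (by rw [support_out]; exact h)) (Quotient.out a).2

/-- The chosen representative does not matter: a permutation relating two orderings relates their
images, with the same sign. -/
theorem push_mk {n : ℕ} (t : X.OrderedCell n) (s : ℤˣ)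
    (h : (OrientedCell.mk t s).support ∈ X.ball σ R) :
    e.push (OrientedCell.mk t s) h = OrientedCell.mk (e.mapOrdered t h) s := by
  obtain ⟨π, h1, h2⟩ := Quotient.exact (s := X.orientedSetoid n)
    (Quotient.out_eq (OrientedCell.mk t s))
  refine Quotient.sound (s := Y.orientedSetoid n) ⟨π, ?_, h2⟩
  ext i
  exact congrArg e.toFun (congrArg (fun f : Fin n ↪ V => f i) h1)

open Classical in
theorem support_push {n : ℕ} (a : X.OrientedCell n) (h : a.support ∈ X.ball σ R) :
    (e.push a h).support = a.support.image e.toFun := by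
  induction a using Quotient.inductionOn with
  | h a =>
  obtain ⟨t, s⟩ := a
  rw [show e.push _ h = OrientedCell.mk (e.mapOrdered t h) s from e.push_mk t s h]
  change Finset.univ.map (e.mapOrdered t h).1 = (Finset.univ.map t.1).image e.toFun
  rw [Finset.map_eq_image, Finset.map_eq_image, Finset.image_image]
  rfl

theorem push_mem_ball (hd : 1 ≤ d) {n k : ℕ} (hk : k ≤ R) {a : X.OrientedCell n}
    (h : a.support ∈ X.ball σ R) (ha : a.support ∈ X.ball σ k) :
    (e.push a h).support ∈ Y.ball τ k := by
  classical
  rw [support_push]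
  exact e.image_mem_ball hd hk ha

theorem symm_push_push {n : ℕ} (a : X.OrientedCell n) (h : a.support ∈ X.ball σ R)
    (h' : (e.push a h).support ∈ Y.ball τ R) : e.symm.push (e.push a h) h' = a := by
  induction a using Quotient.inductionOn with
  | h a =>
  obtain ⟨t, s⟩ := a
  have h1 : e.push _ h = OrientedCell.mk (e.mapOrdered t h) s := e.push_mk t s h
  revert h'
  rw [h1]
  intro h'
  rw [push_mk]
  refine congrArg (fun u => OrientedCell.mk u s) (Subtype.ext ?_)
  ext i
  exact e.left_inv _ (ball_singleton h (Finset.mem_map_of_mem t.1 (Finset.mem_univ i)))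

theorem push_mem_ball_iff (hd : 1 ≤ d) {n k : ℕ} (hk : k ≤ R) {a : X.OrientedCell n}
    (h : a.support ∈ X.ball σ R) : (e.push a h).support ∈ Y.ball τ k ↔ a.support ∈ X.ball σ k := by
  refine ⟨fun h1 => ?_, e.push_mem_ball hd hk h⟩
  have h2 := e.symm.push_mem_ball hd hk (ball_mono hk h1) h1
  rwa [e.symm_push_push] at h2

theorem push_injective (hd : 1 ≤ d) {n : ℕ} {a b : X.OrientedCell n} (ha : a.support ∈ X.ball σ R)
    (hb : b.support ∈ X.ball σ R) (h : e.push a ha = e.push b hb) : a = b := by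
  have h1 := e.push_mem_ball hd le_rfl hb hb
  -- The cell is generalized because the membership proof depends on it.
  have h2 : ∀ x (hx : x.support ∈ Y.ball τ R), x = e.push b hb → e.symm.push x hx = b := by
    rintro x hx rfl
    exact e.symm_push_push b hb hx
  rw [← e.symm_push_push a ha (h ▸ h1)]
  exact h2 _ _ h

theorem push_symm_push {n : ℕ} (b : Y.OrientedCell n) (h : b.support ∈ Y.ball τ R)
    (h' : (e.symm.push b h).support ∈ X.ball σ R) : e.push (e.symm.push b h) h' = b :=
  e.symm.symm_push_push b h h'

theorem push_flip {n : ℕ} (a : X.OrientedCell n) (h : a.support ∈ X.ball σ R)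
    (h' : a.flip.support ∈ X.ball σ R) : e.push a.flip h' = (e.push a h).flip := by
  induction a using Quotient.inductionOn with
  | h a =>
  obtain ⟨t, s⟩ := a
  exact (e.push_mk t (-s) h').trans (congrArg OrientedCell.flip (e.push_mk t s h)).symm

theorem isFace_push {n : ℕ} {a : X.OrientedCell n} {b : X.OrientedCell (n + 1)}
    (ha : a.support ∈ X.ball σ R) (hb : b.support ∈ X.ball σ R) (h : IsFace a b) :
    IsFace (e.push a ha) (e.push b hb) := by
  obtain ⟨t, s, t', i, rfl, h2, rfl⟩ := h
  refine ⟨e.mapOrdered t hb, s, e.mapOrdered t' ha, i, e.push_mk _ _ _, ?_, e.push_mk _ _ _⟩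
  ext j
  exact congrArg e.toFun (congrArg (fun f : Fin n ↪ V => f j) h2)

theorem isFace_push_iff (hd : 1 ≤ d) {n : ℕ} {a : X.OrientedCell n} {b : X.OrientedCell (n + 1)}
    (ha : a.support ∈ X.ball σ R) (hb : b.support ∈ X.ball σ R) :
    IsFace (e.push a ha) (e.push b hb) ↔ IsFace a b := by
  refine ⟨fun h => ?_, e.isFace_push ha hb⟩
  have := e.symm.isFace_push (e.push_mem_ball hd le_rfl ha ha) (e.push_mem_ball hd le_rfl hb hb) h
  rwa [e.symm_push_push, e.symm_push_push] at this

/-- The common `d`-cell must lie in the ball in order to be transported; this is why `a` has to stay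
one step inside. -/
theorem neighbor_push (hd : 1 ≤ d) {k : ℕ} (hk : k + 1 ≤ R) {a b : X.OrientedCell d}
    (ha : a.support ∈ X.ball σ R) (hb : b.support ∈ X.ball σ R) (hak : a.support ∈ X.ball σ k)
    (h : Neighbor a b) : Neighbor (e.push a ha) (e.push b hb) := by
  obtain ⟨hne, t, h1, h2⟩ := h
  have hb' : b.flip.support ∈ X.ball σ R := by rwa [b.support_flip]
  have ht : t.support ∈ X.ball σ R := ball_mono hk (h1.close.mem_ball hd le_rfl hak)
  rw [Neighbor, ← e.push_flip b hb hb']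
  exact ⟨fun h3 => hne (e.push_injective hd _ _ h3), e.push t ht, e.isFace_push _ _ h1,
    e.isFace_push _ _ h2⟩

theorem neighbor_push_iff (hd : 1 ≤ d) {k : ℕ} (hk : k + 1 ≤ R) {a b : X.OrientedCell d}
    (ha : a.support ∈ X.ball σ R) (hb : b.support ∈ X.ball σ R) (hak : a.support ∈ X.ball σ k) :
    Neighbor (e.push a ha) (e.push b hb) ↔ Neighbor a b := by
  refine ⟨fun h => ?_, e.neighbor_push hd hk ha hb hak⟩
  have := e.symm.neighbor_push hd hk (e.push_mem_ball hd le_rfl ha ha)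
    (e.push_mem_ball hd le_rfl hb hb) (e.push_mem_ball hd (by omega) ha hak) h
  rwa [e.symm_push_push, e.symm_push_push] at this

end BallEquiv

/-! ### Convergence of marked complexes yields isomorphisms of balls -/

/-- As `d ≥ 1`, every vertex of an enclosing cell lies in one of its `(d-1)`-faces, and each such
face is at distance zero from `σ`, hence equal to it. -/
theorem mem_ball_zero_iff (hd : 1 ≤ d) {σ : X.Cell} {s : Finset V} :
    s ∈ X.ball σ 0 ↔ s.Nonempty ∧ s ⊆ σ.1 := by
  constructor
  · rintro ⟨hne, t, ht, hst, htc, h⟩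
    refine ⟨hne, ?_⟩
    intro v hv
    obtain ⟨c, hvc, hct, hcc⟩ := Finset.exists_subsuperset_card_eq
      (Finset.singleton_subset_iff.mpr (hst hv)) (by simpa using hd) htc
    have hcf := mem_faces_of_subset ht hct (Finset.card_pos.mp (by omega))
    have h1 := h ⟨c, hcf, hcc⟩ hct
    have h2 : σ = ⟨c, hcf, hcc⟩ := by simpa using h1
    rw [h2]
    exact Finset.singleton_subset_iff.mp hvc
  · rintro ⟨hne, hs⟩
    exact ball_of_subset (center_mem_ball σ 0) hs hne

/-- Radius zero always qualifies, so the infimum in `markedDist` is over a nonempty set and never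
the default value `0` of an empty one. -/
theorem ballIsometric_zero (hd : 1 ≤ d) (σ : X.Cell) (τ : Y.Cell) : BallIsometric X σ Y τ 0 := by
  have hV : ∀ v : V, {v} ∈ X.ball σ 0 ↔ v ∈ σ.1 := fun v => by
    simp [mem_ball_zero_iff hd]
  have hW : ∀ w : W, {w} ∈ Y.ball τ 0 ↔ w ∈ τ.1 := fun w => by
    simp [mem_ball_zero_iff hd]
  let φ : X.BallVertex σ 0 ≃ Y.BallVertex τ 0 :=
    (Equiv.subtypeEquivRight hV).trans ((Finset.equivOfCardEq (σ.2.2.trans τ.2.2.symm)).trans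
      (Equiv.subtypeEquivRight hW).symm)
  refine ⟨φ, fun s => ?_, fun v => ?_⟩
  · rw [mem_ball_zero_iff hd, mem_ball_zero_iff hd, Finset.map_nonempty, Finset.map_nonempty,
      Finset.map_nonempty]
    refine and_congr_right fun _ => ⟨fun _ => ?_, fun _ => ?_⟩
    · intro w hw
      obtain ⟨w', -, rfl⟩ := Finset.mem_map.mp hw
      exact (hW _).mp w'.2
    · intro w hw
      obtain ⟨w', -, rfl⟩ := Finset.mem_map.mp hw
      exact (hV _).mp w'.2
  · exact iff_of_true ((hV _).mp v.2) ((hW _).mp (φ v).2)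

theorem exists_ballIsometric_of_markedDist_lt (hd : 1 ≤ d) {σ : X.Cell} {τ : Y.Cell} {r : ℕ}
    (h : markedDist X σ Y τ < 1 / ((r : ℝ) + 1)) : ∃ R, r ≤ R ∧ BallIsometric X σ Y τ R := by
  unfold markedDist at h
  obtain ⟨x, ⟨R, hR, rfl⟩, hx⟩ := exists_lt_of_csInf_lt
    (by exact ⟨_, 0, ballIsometric_zero hd σ τ, rfl⟩) h
  refine ⟨R, ?_, hR⟩
  rw [one_div_lt_one_div (by positivity) (by positivity)] at hx
  have : (r : ℝ) < R := by linarith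
  exact_mod_cast this.le

open Classical in
theorem exists_ballEquiv_of_ballIsometric {σ : X.Cell} {τ : Y.Cell} {R : ℕ}
    (h : BallIsometric X σ Y τ R) : Nonempty (BallEquiv X σ Y τ R) := by
  obtain ⟨φ, hφ, hc⟩ := h
  -- These vertices are the default values of the two functions outside the balls.
  obtain ⟨v₀, -⟩ := nonempty_of_mem_faces σ.2.1
  obtain ⟨w₀, -⟩ := nonempty_of_mem_faces τ.2.1
  let f : V → W := fun v => if h : {v} ∈ X.ball σ R then (φ ⟨v, h⟩).1 else w₀
  let g : W → V := fun w => if h : {w} ∈ Y.ball τ R then (φ.symm ⟨w, h⟩).1 else v₀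
  have hf : ∀ v : X.BallVertex σ R, f v.1 = (φ v).1 := fun v => dif_pos v.2
  have hg : ∀ w : Y.BallVertex τ R, g w.1 = (φ.symm w).1 := fun w => dif_pos w.2
  have himg : ∀ s : Finset (X.BallVertex σ R),
      (s.map (Function.Embedding.subtype _)).image f =
        (s.map φ.toEmbedding).map (Function.Embedding.subtype _) := fun s => by
    rw [Finset.map_map, Finset.map_eq_image, Finset.map_eq_image, Finset.image_image]
    exact Finset.image_congr fun v _ => hf v
  have himg' : ∀ s : Finset (X.BallVertex σ R),
      ((s.map φ.toEmbedding).map (Function.Embedding.subtype _)).image g =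
        s.map (Function.Embedding.subtype _) := fun s => by
    rw [Finset.map_map, Finset.map_eq_image, Finset.map_eq_image, Finset.image_image]
    refine Finset.image_congr fun v _ => ?_
    exact (hg (φ v)).trans (congrArg Subtype.val (φ.symm_apply_apply v))
  have hlift : ∀ s ∈ X.ball σ R, ∃ s' : Finset (X.BallVertex σ R),
      s = s'.map (Function.Embedding.subtype _) := fun s hs =>
    ⟨s.subtype _, (Finset.subtype_map_of_mem fun v hv => ball_singleton hs hv).symm⟩
  have hlift' : ∀ s ∈ Y.ball τ R, ∃ s' : Finset (X.BallVertex σ R),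
      s = (s'.map φ.toEmbedding).map (Function.Embedding.subtype _) := fun s hs => by
    refine ⟨(s.subtype fun w => {w} ∈ Y.ball τ R).map φ.symm.toEmbedding, ?_⟩
    rw [Finset.map_map (g := φ.toEmbedding)]
    rw [show φ.symm.toEmbedding.trans φ.toEmbedding = Function.Embedding.refl _ by ext; simp,
      Finset.map_refl]
    exact (Finset.subtype_map_of_mem fun v hv => ball_singleton hs hv).symm
  have hcenter : σ.1.image f = τ.1 := by
    ext w
    rw [Finset.mem_image]
    constructor
    · rintro ⟨v, hv, rfl⟩
      have hvb := ball_singleton (center_mem_ball σ R) hv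
      rw [hf ⟨v, hvb⟩]
      exact (hc ⟨v, hvb⟩).mp hv
    · intro hw
      have hwb := ball_singleton (center_mem_ball τ R) hw
      refine ⟨(φ.symm ⟨w, hwb⟩).1, (hc _).mpr ?_, ?_⟩
      · rw [φ.apply_symm_apply]; exact hw
      · rw [hf, φ.apply_symm_apply]
  refine ⟨⟨f, g, ?_, ?_, ?_, ?_, hcenter, ?_⟩⟩
  · intro s hs
    obtain ⟨s', rfl⟩ := hlift s hs
    rw [himg]
    exact (hφ s').mp hs
  · intro s hs
    obtain ⟨s', rfl⟩ := hlift' s hs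
    rw [himg']
    exact (hφ s').mpr hs
  · intro v hv
    rw [hf ⟨v, hv⟩, hg, φ.symm_apply_apply]
  · intro w hw
    rw [hg ⟨w, hw⟩, hf, φ.apply_symm_apply]
  · obtain ⟨s', hs'⟩ := hlift σ.1 (center_mem_ball σ R)
    rw [← hcenter, hs', himg, himg']

end

end UniformComplex

namespace UniformComplex

noncomputable section

variable {V : Type*} {d : ℕ} {X : UniformComplex V d}
variable {W : Type*} {Y : UniformComplex W d}

/-! ### Transport of forms -/

/-- The form `f` vanishes outside the ball of radius `r` around `τ`. -/
def SupportedInBall {n : ℕ} (f : Y.OmegaL2 n) (τ : Y.Cell) (r : ℕ) : Prop :=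
  ∀ b, f b ≠ 0 → b.support ∈ Y.ball τ r

theorem SupportedInBall.mono {n : ℕ} {f : Y.OmegaL2 n} {τ : Y.Cell} {r k : ℕ}
    (h : SupportedInBall f τ r) (hrk : r ≤ k) : SupportedInBall f τ k :=
  fun b hb => ball_mono hrk (h b hb)

/-- A nonzero value at `b` needs a nonzero term at some cell sharing a `d`-cell with `b`. -/
theorem SupportedInBall.kernelOperator (hd : 1 ≤ d) {m n : ℕ} (hm : d ≤ m) (hn : d ≤ n)
    (R : Y.OrientedCell m → Y.OrientedCell n → Prop) (c : Finset W → ℝ)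
    (hR : ∀ a b, R a b → R a.flip b.flip) (hclose : ∀ a b, R a b → Close a b)
    (hc : ∀ σ ∈ Y.faces, |c σ| ≤ 1) {f : Y.OmegaL2 m} {τ : Y.Cell} {r : ℕ}
    (hf : SupportedInBall f τ r) :
    SupportedInBall (Y.kernelOperator hm hn R c hR hclose hc f) τ (r + 1) := by
  intro b hb
  rw [kernelOperator_apply] at hb
  obtain ⟨a, hab, ha⟩ := exists_ne_zero_of_finsum_mem_ne_zero hb
  exact (hclose a b hab).mem_ball hd hm (hf a (right_ne_zero_of_mul ha))

namespace BallEquiv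

variable {σ : X.Cell} {τ : Y.Cell} {R : ℕ} (e : BallEquiv X σ Y τ (R + 1))

/-- The map on the oriented cells of the ball of radius `R`. -/
def pushBall (n : ℕ) (a : {a : X.OrientedCell n // a.support ∈ X.ball σ R}) : Y.OrientedCell n :=
  e.push a.1 (ball_mono (Nat.le_succ R) a.2)

theorem pushBall_injective (hd : 1 ≤ d) (n : ℕ) : Function.Injective (e.pushBall n) :=
  fun _ _ h => Subtype.ext (e.push_injective hd _ _ h)

theorem mem_range_pushBall (hd : 1 ≤ d) {n : ℕ} {b : Y.OrientedCell n}
    (hb : b.support ∈ Y.ball τ R) : b ∈ Set.range (e.pushBall n) := by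
  have hb' := ball_mono (Nat.le_succ R) hb
  exact ⟨⟨e.symm.push b hb', e.symm.push_mem_ball hd (Nat.le_succ R) hb' hb⟩,
    e.push_symm_push b hb' _⟩

/-- This is one use of the isomorphism having radius `R + 1` while forms are transported only on
radius `R`: degrees are preserved one step inside. -/
theorem weight_push (hd : 1 ≤ d) {n : ℕ} {a : X.OrientedCell n} (ha : a.support ∈ X.ball σ R)
    (h : a.support ∈ X.ball σ (R + 1)) : Y.weight (e.push a h).support = X.weight a.support := by
  classical
  rw [support_push]
  exact e.weight_image hd le_rfl ha

open Classical in
/-- The values of the transported form: `f` composed with the isomorphism on the ball of radius `R`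
and zero outside. -/
def pullFun {n : ℕ} (f : Y.OmegaL2 n) (a : X.OrientedCell n) : ℝ :=
  if h : a.support ∈ X.ball σ R then f (e.pushBall n ⟨a, h⟩) else 0

theorem pullFun_of_mem {n : ℕ} (f : Y.OmegaL2 n) {a : X.OrientedCell n}
    (h : a.support ∈ X.ball σ R) : e.pullFun f a = f (e.pushBall n ⟨a, h⟩) := dif_pos h

theorem pullFun_of_notMem {n : ℕ} (f : Y.OmegaL2 n) {a : X.OrientedCell n}
    (h : a.support ∉ X.ball σ R) : e.pullFun f a = 0 := dif_neg h

/-- This matching of the weighted squares gives both the summability and the norm of the transported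
form. -/
theorem pullFun_comp_val (hd : 1 ≤ d) {n : ℕ} (f : Y.OmegaL2 n) :
    (fun a : X.OrientedCell n => X.weight a.support * e.pullFun f a ^ 2) ∘
        (Subtype.val : {a : X.OrientedCell n // a.support ∈ X.ball σ R} → X.OrientedCell n) =
      (fun b => Y.weight b.support * f b ^ 2) ∘ e.pushBall n := by
  funext a
  simp only [Function.comp_apply]
  rw [e.pullFun_of_mem f a.2, ← e.weight_push hd a.2 (ball_mono (Nat.le_succ R) a.2)]
  rfl

/-- The transport of forms along an isomorphism of balls. -/
def pull (hd : 1 ≤ d) {n : ℕ} (f : Y.OmegaL2 n) : X.OmegaL2 n :=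
  ⟨e.pullFun f, by
    refine ⟨fun a => ?_, ?_⟩
    · by_cases h : a.support ∈ X.ball σ R
      · have h' : a.flip.support ∈ X.ball σ R := by rwa [a.support_flip]
        rw [e.pullFun_of_mem f h, e.pullFun_of_mem f h', ← f.2.1]
        exact congrArg f.1 (e.push_flip a _ _)
      · have h' : a.flip.support ∉ X.ball σ R := by rwa [a.support_flip]
        rw [e.pullFun_of_notMem f h, e.pullFun_of_notMem f h', neg_zero]
    · have h1 := f.2.2.comp_injective (e.pushBall_injective hd n)
      rw [← e.pullFun_comp_val hd] at h1
      refine (Subtype.val_injective.summable_iff fun a ha => ?_).mp h1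
      rw [e.pullFun_of_notMem f fun h => ha ⟨⟨a, h⟩, rfl⟩]
      simp⟩

theorem pull_of_mem (hd : 1 ≤ d) {n : ℕ} (f : Y.OmegaL2 n) {a : X.OrientedCell n}
    (h : a.support ∈ X.ball σ R) :
    e.pull hd f a = f (e.push a (ball_mono (Nat.le_succ R) h)) := e.pullFun_of_mem f h

theorem pull_of_notMem (hd : 1 ≤ d) {n : ℕ} (f : Y.OmegaL2 n) {a : X.OrientedCell n}
    (h : a.support ∉ X.ball σ R) : e.pull hd f a = 0 := e.pullFun_of_notMem f h

theorem pull_sub (hd : 1 ≤ d) {n : ℕ} (f g : Y.OmegaL2 n) :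
    e.pull hd (f - g) = e.pull hd f - e.pull hd g := by
  refine OmegaL2.ext X fun a => ?_
  by_cases h : a.support ∈ X.ball σ R
  · rw [OmegaL2.sub_apply, pull_of_mem _ _ _ h, pull_of_mem _ _ _ h, pull_of_mem _ _ _ h]
    rfl
  · rw [OmegaL2.sub_apply, pull_of_notMem _ _ _ h, pull_of_notMem _ _ _ h, pull_of_notMem _ _ _ h,
      sub_zero]

theorem pull_smul (hd : 1 ≤ d) {n : ℕ} (c : ℝ) (f : Y.OmegaL2 n) :
    e.pull hd (c • f) = c • e.pull hd f := by
  refine OmegaL2.ext X fun a => ?_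
  by_cases h : a.support ∈ X.ball σ R
  · rw [OmegaL2.smul_apply, pull_of_mem _ _ _ h, pull_of_mem _ _ _ h]
    rfl
  · rw [OmegaL2.smul_apply, pull_of_notMem _ _ _ h, pull_of_notMem _ _ _ h, mul_zero]

/-- Both series vanish off the balls of radius `R`, and on these the isomorphism matches them term
by term. -/
theorem norm_pull (hd : 1 ≤ d) {n : ℕ} {f : Y.OmegaL2 n} (hf : SupportedInBall f τ R) :
    ‖e.pull hd f‖ = ‖f‖ := by
  rw [← sq_eq_sq₀ (norm_nonneg _) (norm_nonneg _), OmegaL2.norm_sq, OmegaL2.norm_sq]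
  congr 1
  have h1 : Function.support (fun a => X.weight a.support * e.pullFun f a ^ 2) ⊆
      Set.range (Subtype.val :
        {a : X.OrientedCell n // a.support ∈ X.ball σ R} → X.OrientedCell n) := fun a ha => by
    by_contra h
    refine ha ?_
    dsimp only
    rw [e.pullFun_of_notMem f fun h' => h ⟨⟨a, h'⟩, rfl⟩]
    simp
  have h2 : Function.support (fun b => Y.weight b.support * f b ^ 2) ⊆
      Set.range (e.pushBall n) := fun b hb => by
    refine e.mem_range_pushBall hd (hf b fun h => hb ?_)
    simp [h]
  have h3 := Subtype.val_injective.tsum_eq h1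
  have h4 := (e.pushBall_injective hd n).tsum_eq h2
  refine h3.symm.trans (Eq.trans ?_ h4)
  exact tsum_congr fun a => congrFun (e.pullFun_comp_val hd f) a

theorem supportedInBall_pull (hd : 1 ≤ d) {n r : ℕ} (hr : r ≤ R) {f : Y.OmegaL2 n}
    (hf : SupportedInBall f τ r) : SupportedInBall (e.pull hd f) σ r := by
  intro a ha
  by_cases h : a.support ∈ X.ball σ R
  · rw [e.pull_of_mem hd f h] at ha
    exact (e.push_mem_ball_iff hd (by omega) _).mp (hf _ ha)
  · exact absurd (e.pull_of_notMem hd f h) ha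

/-- The transport of forms intertwines kernel operators given by corresponding relations. -/
theorem kernelOperator_pull (hd : 1 ≤ d) {m n : ℕ} (hm : d ≤ m) (hn : d ≤ n)
    (K : X.OrientedCell m → X.OrientedCell n → Prop) (c : Finset V → ℝ)
    (hK : ∀ a b, K a b → K a.flip b.flip) (hclose : ∀ a b, K a b → Close a b)
    (hc : ∀ σ ∈ X.faces, |c σ| ≤ 1)
    (K' : Y.OrientedCell m → Y.OrientedCell n → Prop) (c' : Finset W → ℝ)
    (hK' : ∀ a b, K' a b → K' a.flip b.flip) (hclose' : ∀ a b, K' a b → Close a b)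
    (hc' : ∀ σ ∈ Y.faces, |c' σ| ≤ 1)
    (hKK' : ∀ a b (ha : a.support ∈ X.ball σ (R + 1)) (hb : b.support ∈ X.ball σ (R + 1)),
      b.support ∈ X.ball σ R → (K' (e.push a ha) (e.push b hb) ↔ K a b))
    (hcw : ∀ a : X.OrientedCell m, c a.support = X.weight a.support)
    (hcw' : ∀ b : Y.OrientedCell m, c' b.support = Y.weight b.support)
    {r : ℕ} (hr : r + 1 ≤ R) {f : Y.OmegaL2 m} (hf : SupportedInBall f τ r) :
    X.kernelOperator hm hn K c hK hclose hc (e.pull hd f) =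
      e.pull hd (Y.kernelOperator hm hn K' c' hK' hclose' hc' f) := by
  refine OmegaL2.ext X fun b => ?_
  by_cases hb : b.support ∈ X.ball σ R
  · have hb' := ball_mono (Nat.le_succ R) hb
    rw [e.pull_of_mem hd _ hb, kernelOperator_apply, kernelOperator_apply,
      ← finsum_set_coe_eq_finsum_mem, ← finsum_set_coe_eq_finsum_mem]
    -- For `b` in the ball of radius `R`, all related cells lie within `R + 1`, so the isomorphism
    -- is a bijection between the index sets of the two sums.
    have hball : ∀ a, K a b → a.support ∈ X.ball σ (R + 1) := fun a ha =>
      (hclose a b ha).symm.mem_ball hd hn hb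
    have hball' : ∀ a, K' a (e.push b hb') → a.support ∈ Y.ball τ (R + 1) := fun a ha =>
      (hclose' a _ ha).symm.mem_ball hd hn (e.push_mem_ball hd (Nat.le_succ R) hb' hb)
    refine finsum_eq_of_bijective
      (fun a : {a | K a b} => (⟨e.push a.1 (hball a.1 a.2),
        (hKK' a.1 b (hball a.1 a.2) hb' hb).mpr a.2⟩ : {a | K' a (e.push b hb')})) ⟨?_, ?_⟩ ?_
    · intro a a' h
      exact Subtype.ext (e.push_injective hd (hball _ a.2) (hball _ a'.2) (congrArg Subtype.val h))
    · rintro ⟨a, ha⟩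
      have h1 := hball' a ha
      have h2 := e.symm.push_mem_ball hd le_rfl h1 h1
      refine ⟨⟨e.symm.push a h1, ?_⟩, Subtype.ext (e.push_symm_push a h1 h2)⟩
      refine (hKK' _ b h2 hb' hb).mp ?_
      rw [e.push_symm_push a h1 h2]
      exact ha
    · rintro ⟨a, ha⟩
      dsimp only
      have h1 := hball a ha
      -- In the outer shell the transported form is zero by definition, and `f` is zero at the
      -- corresponding cell by its support.
      by_cases h : a.support ∈ X.ball σ R
      · rw [e.pull_of_mem hd f h, hcw, hcw', e.weight_push hd h]
      · have h2 : f (e.push a h1) = 0 := by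
          by_contra h3
          exact h ((e.push_mem_ball_iff hd (Nat.le_succ R) h1).mp
            (ball_mono (by omega) (hf _ h3)))
        rw [e.pull_of_notMem hd f h, h2, mul_zero, mul_zero]
  -- Off the ball of radius `R` the left side vanishes too, its support having radius at most `r + 1
  -- ≤ R`.
  · rw [e.pull_of_notMem hd _ hb]
    by_contra h
    exact hb (ball_mono hr (SupportedInBall.kernelOperator hd hm hn K c hK hclose hc
      (e.supportedInBall_pull hd (by omega) hf) b h))

theorem neighborSum_pull (hd : 1 ≤ d) {r : ℕ} (hr : r + 1 ≤ R) {f : Y.OmegaL2 d}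
    (hf : SupportedInBall f τ r) : X.neighborSum (e.pull hd f) = e.pull hd (Y.neighborSum f) :=
  e.kernelOperator_pull hd _ _ _ _ _ _ _ _ _ _ _ _
    (fun _ _ ha hb hbR => e.neighbor_push_iff hd le_rfl hb ha hbR)
    (fun a => (X.weight_orientedCell a).symm) (fun a => (Y.weight_orientedCell a).symm) hr hf

theorem transitionOperator_pull (hd : 1 ≤ d) {r : ℕ} (hr : r + 1 ≤ R) {f : Y.OmegaL2 d}
    (hf : SupportedInBall f τ r) :
    X.transitionOperator 0 (e.pull hd f) = e.pull hd (Y.transitionOperator 0 f) := by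
  rw [transitionOperator_zero_apply, transitionOperator_zero_apply, pull_smul,
    e.neighborSum_pull hd hr hf]

theorem coboundary_pull (hd : 1 ≤ d) {r : ℕ} (hr : r + 1 ≤ R) {f : Y.OmegaL2 d}
    (hf : SupportedInBall f τ r) : X.coboundary (e.pull hd f) = e.pull hd (Y.coboundary f) :=
  e.kernelOperator_pull hd _ _ _ _ _ _ _ _ _ _ _ _
    (fun _ _ ha hb _ => e.isFace_push_iff hd ha hb)
    (fun a => (X.weight_orientedCell a).symm) (fun a => (Y.weight_orientedCell a).symm) hr hf

theorem boundary_pull (hd : 1 ≤ d) {r : ℕ} (hr : r + 1 ≤ R) {f : Y.OmegaL2 (d + 1)}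
    (hf : SupportedInBall f τ r) : X.boundary (e.pull hd f) = e.pull hd (Y.boundary f) :=
  e.kernelOperator_pull hd _ _ _ _ _ _ _ _ _ _ _ _
    (fun _ _ ha hb _ => e.isFace_push_iff hd hb ha)
    (fun a => (X.weight_orientedCell_succ a).symm) (fun a => (Y.weight_orientedCell_succ a).symm)
    hr hf

theorem upperLaplacian_pull (hd : 1 ≤ d) {r : ℕ} (hr : r + 2 ≤ R) {f : Y.OmegaL2 d}
    (hf : SupportedInBall f τ r) :
    X.upperLaplacian (e.pull hd f) = e.pull hd (Y.upperLaplacian f) := by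
  change X.boundary (X.coboundary (e.pull hd f)) = e.pull hd (Y.boundary (Y.coboundary f))
  rw [e.coboundary_pull hd (by omega) hf]
  exact e.boundary_pull hd hr (SupportedInBall.kernelOperator hd _ _ _ _ _ _ _ hf)

end BallEquiv

/-- One step would suffice; `r + 2` is the bound shared with the upper Laplacian. -/
theorem SupportedInBall.transitionOperator (hd : 1 ≤ d) {f : Y.OmegaL2 d} {τ : Y.Cell} {r : ℕ}
    (hf : SupportedInBall f τ r) : SupportedInBall (Y.transitionOperator 0 f) τ (r + 2) := by
  intro b hb
  rw [transitionOperator_zero_apply, OmegaL2.smul_apply] at hb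
  exact ball_mono (Nat.le_succ _) (SupportedInBall.kernelOperator hd _ _ _ _ _ _ _ hf b
    (right_ne_zero_of_mul hb))

theorem SupportedInBall.upperLaplacian (hd : 1 ≤ d) {f : Y.OmegaL2 d} {τ : Y.Cell} {r : ℕ}
    (hf : SupportedInBall f τ r) : SupportedInBall (Y.upperLaplacian f) τ (r + 2) := by
  change SupportedInBall (Y.boundary (Y.coboundary f)) τ (r + 2)
  exact SupportedInBall.kernelOperator hd _ _ _ _ _ _ _
    (SupportedInBall.kernelOperator hd _ _ _ _ _ _ _ hf)

/-! ### Approximation by forms supported in balls -/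

open Classical in
/-- The restriction of a form to a ball. -/
def restrictBall {n : ℕ} (f : Y.OmegaL2 n) (τ : Y.Cell) (r : ℕ) : Y.OmegaL2 n :=
  ⟨fun b => if b.support ∈ Y.ball τ r then f b else 0, by
    refine ⟨fun b => ?_, ?_⟩
    · dsimp only
      rw [b.support_flip, f.2.1 b]
      split_ifs
      · rfl
      · exact neg_zero.symm
    · refine Summable.of_nonneg_of_le (fun b => mul_nonneg (Y.weight_pos b).le (sq_nonneg _))
        (fun b => ?_) f.2.2
      refine mul_le_mul_of_nonneg_left ?_ (Y.weight_pos b).le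
      dsimp only
      split_ifs
      · exact le_rfl
      · simpa using sq_nonneg (f b)⟩

theorem supportedInBall_restrictBall {n : ℕ} (f : Y.OmegaL2 n) (τ : Y.Cell) (r : ℕ) :
    SupportedInBall (restrictBall f τ r) τ r := by
  intro b hb
  by_contra h
  exact hb (if_neg h)

/-- Each cell eventually lies in the ball, so the error tends to zero cellwise, dominated by the
summable `weight * f ^ 2`. -/
theorem tendsto_restrictBall (hd : 1 ≤ d) (hY : Y.IsConnected) {n : ℕ} (f : Y.OmegaL2 n)
    (τ : Y.Cell) : Tendsto (fun r => restrictBall f τ r) atTop (𝓝 f) := by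
  classical
  rw [tendsto_iff_norm_sub_tendsto_zero]
  have hle : ∀ r b, |(restrictBall f τ r - f) b| ≤ |f b| := fun r b => by
    rw [OmegaL2.sub_apply]
    change |(if b.support ∈ Y.ball τ r then f b else 0) - f b| ≤ _
    split_ifs
    · simp
    · simp
  have hsq : Tendsto (fun r => ‖restrictBall f τ r - f‖ ^ 2) atTop (𝓝 0) := by
    simp_rw [OmegaL2.norm_sq]
    rw [show (0 : ℝ) = (1 / 2) * ∑' _ : Y.OrientedCell n, (0 : ℝ) by simp]
    refine Tendsto.const_mul _ (tendsto_tsum_of_dominated_convergence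
      (bound := fun b => Y.weight b.support * f b ^ 2) f.2.2 (fun b => ?_)
      (Eventually.of_forall fun r b => ?_))
    · obtain ⟨k, hk⟩ := exists_mem_ball hd hY τ b.support_mem
      refine tendsto_const_nhds.congr' ?_
      filter_upwards [eventually_ge_atTop k] with r hr
      rw [OmegaL2.sub_apply]
      change 0 = _ * ((if b.support ∈ Y.ball τ r then f b else 0) - f b) ^ 2
      rw [if_pos (ball_mono hr hk)]
      simp
    · rw [Real.norm_eq_abs, abs_mul, abs_of_nonneg (Y.weight_pos b).le, abs_pow, ← sq_abs (f b)]
      exact mul_le_mul_of_nonneg_left (pow_le_pow_left₀ (abs_nonneg _) (hle r b) 2)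
        (Y.weight_pos b).le
  have h := hsq.sqrt
  simpa [Real.sqrt_sq (norm_nonneg _)] using h

/-! ### Convergence of the spectra -/

/-- Along a convergent sequence of complexes, every point of the spectrum of `T` is a limit of points
of the spectra of the `S n`, for symmetric operators that increase supports by at most two and are
compatible with isomorphisms of balls. -/
theorem exists_tendsto_mem_spectrum (hd : 1 ≤ d) {V : ℕ → Type*} {W : Type*}
    {X : ∀ n, UniformComplex (V n) d} {Y : UniformComplex W d} (hY : Y.IsConnected)
    (hconv : ConvergesTo X Y)
    (S : ∀ n, (X n).OmegaL2 d →L[ℝ] (X n).OmegaL2 d) (T : Y.OmegaL2 d →L[ℝ] Y.OmegaL2 d)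
    (hS : ∀ n, (S n : (X n).OmegaL2 d →ₗ[ℝ] (X n).OmegaL2 d).IsSymmetric)
    (hT : (T : Y.OmegaL2 d →ₗ[ℝ] Y.OmegaL2 d).IsSymmetric)
    (hsupp : ∀ (τ : Y.Cell) (r : ℕ) (f : Y.OmegaL2 d), SupportedInBall f τ r →
      SupportedInBall (T f) τ (r + 2))
    (hST : ∀ n (σ : (X n).Cell) (τ : Y.Cell) (R r : ℕ) (e : BallEquiv (X n) σ Y τ (R + 1))
      (f : Y.OmegaL2 d), r + 2 ≤ R → SupportedInBall f τ r →
      S n (e.pull hd f) = e.pull hd (T f))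
    {l : ℝ} (hl : l ∈ spectrum ℝ T) :
    ∃ s : ℕ → ℝ, (∀ n, s n ∈ spectrum ℝ (S n)) ∧ Tendsto s atTop (𝓝 l) := by
  obtain ⟨-, σ, τ, hdist⟩ := hconv
  -- Any nonzero form is an approximate eigenvector for `0` with error `‖S n f‖ / ‖f‖`, which
  -- already yields a spectral point.
  have hne : ∀ n, (spectrum ℝ (S n)).Nonempty := fun n => by
    obtain ⟨a, -⟩ := (X n).exists_orientedCell (σ n).2.1 (σ n).2.2
    have := (X n).nontrivial_omegaL2 a
    obtain ⟨f, hf⟩ := exists_ne (0 : (X n).OmegaL2 d)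
    obtain ⟨s, hs, -⟩ := (S n).exists_mem_spectrum_abs_sub_le (hS n) (l := 0)
      (ε := ‖S n f‖ / ‖f‖) hf (by rw [zero_smul, sub_zero,
        div_mul_cancel₀ _ (norm_ne_zero_iff.mpr hf)])
    exact ⟨s, hs⟩
  have hclose : ∀ ε > 0, ∀ᶠ n in atTop, ∃ s ∈ spectrum ℝ (S n), |s - l| ≤ ε := by
    intro ε hε
    obtain ⟨f, hf⟩ := T.exists_norm_sub_smul_lt hT hl hε
    have hlim := tendsto_restrictBall hd hY f τ
    have h1 : Tendsto (fun r => ‖T (restrictBall f τ r) - l • restrictBall f τ r‖) atTop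
        (𝓝 ‖T f - l • f‖) :=
      (((T.continuous.tendsto f).comp hlim).sub (hlim.const_smul l)).norm
    have h2 : Tendsto (fun r => ε * ‖restrictBall f τ r‖) atTop (𝓝 (ε * ‖f‖)) :=
      hlim.norm.const_mul ε
    obtain ⟨r, hr⟩ := (h1.eventually_lt h2 hf).exists
    set g := restrictBall f τ r with hg
    have hgs : SupportedInBall g τ r := supportedInBall_restrictBall f τ r
    -- Radius `r + 3` leaves two steps for the operator and one for the margin `R + 1` of the
    -- transport.
    have hev : ∀ᶠ n in atTop, markedDist (X n) (σ n) Y τ < 1 / (((r + 3 : ℕ) : ℝ) + 1) :=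
      hdist.eventually_lt_const (by positivity)
    filter_upwards [hev] with n hn
    obtain ⟨R', hR', hiso⟩ := exists_ballIsometric_of_markedDist_lt hd hn
    obtain ⟨R, rfl⟩ : ∃ R, R' = R + 1 := ⟨R' - 1, by omega⟩
    obtain ⟨e⟩ := exists_ballEquiv_of_ballIsometric hiso
    have hTg : SupportedInBall (T g - l • g) τ R := by
      intro b hb
      rw [OmegaL2.sub_apply, OmegaL2.smul_apply] at hb
      by_cases h0 : g b = 0
      · rw [h0, mul_zero, sub_zero] at hb
        exact ball_mono (by omega) (hsupp τ r g hgs b hb)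
      · exact ball_mono (by omega) (hgs b h0)
    have hnorm : ‖S n (e.pull hd g) - l • e.pull hd g‖ < ε * ‖e.pull hd g‖ := by
      rw [hST n (σ n) τ R r e g (by omega) hgs, ← e.pull_smul, ← e.pull_sub, e.norm_pull hd hTg,
        e.norm_pull hd (hgs.mono (by omega))]
      exact hr
    -- The inequality is strict, so it excludes the zero form.
    have hne0 : e.pull hd g ≠ 0 := by
      intro h0
      rw [h0] at hnorm
      simp at hnorm
    exact (S n).exists_mem_spectrum_abs_sub_le (hS n) hne0 hnorm.le
  -- Choosing within `1 / (n + 1)` of the infimal distance gives one sequence for all `ε`, with no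
  -- need for a nearest point.
  have hchoice : ∀ n : ℕ, ∃ s ∈ spectrum ℝ (S n),
      dist l s < Metric.infDist l (spectrum ℝ (S n)) + 1 / ((n : ℝ) + 1) := fun n =>
    (Metric.infDist_lt_iff (hne n)).mp (lt_add_of_pos_right _ (by positivity))
  choose s hs hsd using hchoice
  refine ⟨s, hs, ?_⟩
  have hinf : Tendsto (fun n => Metric.infDist l (spectrum ℝ (S n))) atTop (𝓝 0) := by
    rw [Metric.tendsto_atTop']
    intro ε hε
    obtain ⟨N, hN⟩ := eventually_atTop.mp (hclose (ε / 2) (half_pos hε))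
    refine ⟨N, fun n hn => ?_⟩
    obtain ⟨x, hx, hxl⟩ := hN n hn.le
    rw [Real.dist_eq, sub_zero, abs_of_nonneg Metric.infDist_nonneg]
    refine (Metric.infDist_le_dist_of_mem hx).trans_lt ?_
    rw [dist_comm, Real.dist_eq]
    linarith
  rw [tendsto_iff_dist_tendsto_zero]
  refine squeeze_zero (fun n => dist_nonneg) (fun n => ?_)
    (by simpa using hinf.add tendsto_one_div_add_atTop_nhds_zero_nat)
  rw [dist_comm]
  simpa using (hsd n).le

end

end UniformComplex

/-! ### The walk operator and the upper Laplacian as instances of the general convergence -/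

theorem theorem3p8 {d : ℕ} (hd : 1 ≤ d) {V : ℕ → Type*} {W : Type*}
    (X : ∀ n, UniformComplex (V n) d) (Y : UniformComplex W d)
    (hX : ∀ n, (X n).IsConnected) (hY : Y.IsConnected)
    (hconv : UniformComplex.ConvergesTo X Y) :
    (∀ l ∈ spectrum ℝ (Y.transitionOperator 0), ∃ s : ℕ → ℝ,
      (∀ n, s n ∈ spectrum ℝ ((X n).transitionOperator 0)) ∧ Tendsto s atTop (𝓝 l)) ∧
    (∀ l ∈ spectrum ℝ Y.upperLaplacian, ∃ s : ℕ → ℝ,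
      (∀ n, s n ∈ spectrum ℝ (X n).upperLaplacian) ∧ Tendsto s atTop (𝓝 l)) ∧
    spectrum ℝ (Y.transitionOperator 0) ⊆
      closure (⋃ n, spectrum ℝ ((X n).transitionOperator 0)) := by
  have hA : ∀ l ∈ spectrum ℝ (Y.transitionOperator 0), ∃ s : ℕ → ℝ,
      (∀ n, s n ∈ spectrum ℝ ((X n).transitionOperator 0)) ∧ Tendsto s atTop (𝓝 l) :=
    fun l hl => UniformComplex.exists_tendsto_mem_spectrum hd hY hconv
      (fun n => (X n).transitionOperator 0) (Y.transitionOperator 0)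
      (fun n => (X n).isSymmetric_transitionOperator) Y.isSymmetric_transitionOperator
      (fun _ _ _ hf => hf.transitionOperator hd)
      (fun _ _ _ _ _ e _ hr hf => e.transitionOperator_pull hd (by omega) hf) hl
  refine ⟨hA, fun l hl => ?_, fun l hl => ?_⟩
  · exact UniformComplex.exists_tendsto_mem_spectrum hd hY hconv
      (fun n => (X n).upperLaplacian) Y.upperLaplacian
      (fun n => (X n).isSymmetric_upperLaplacian) Y.isSymmetric_upperLaplacian
      (fun _ _ _ hf => hf.upperLaplacian hd)
      (fun _ _ _ _ _ e _ hr hf => e.upperLaplacian_pull hd hr hf) hl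
  · obtain ⟨s, hs, hlim⟩ := hA l hl
    exact mem_closure_of_tendsto hlim
      (Eventually.of_forall fun n => Set.mem_iUnion.mpr ⟨n, hs n⟩)
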